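/- **Setting.** Let $\mathrm L:\mathcal S'(\mathbb R)\to\mathcal S'(\mathbb R)$ be a continuous linear operator that maps real tempered distributions to real ones and is *spline-admissible*: it is shift-invariant, it has a real Green's function $\rho_{\mathrm L}\in\mathcal S'(\mathbb R)$ with $\mathrm L\rho_{\mathrm L}=\delta$, and, with the search space $$\mathcal X_2=\{f\in\mathcal S'(\mathbb R)\text{ real}:\ \|\mathrm Lf\|_{L_2}<\infty\},$$ its null space $\mathcal N_{\mathrm L}=\{p\in\mathcal X_2:\mathrm Lp=0\}$ is finite-dimensional, with basis $p_1,\dots,p_{N_0}$. Let $\widehat{\mathrm L}$ be the frequency response of $\mathrm L$ (so $\mathrm L\{e^{2\pi i\xi\cdot}\}=\widehat{\mathrm L}(\xi)e^{2\pi i\xi\cdot}$ for all $\xi\in\mathbb R$; $\widehat f$ or $\mathcal F f$ denotes the Fourier transform in the same normalization), $\mathrm L^*$ the adjoint of $\mathrm L$ (the shift-invariant operator with frequency response $\overline{\widehat{\mathrm L}}$), and let $\rho\in\mathcal S'(\mathbb R)$ be a real Green's function of $\mathrm L^*\mathrm L$, i.e. $\mathrm L^*\mathrm L\rho=\delta$.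 Let $\mathrm H:\mathcal X_2\to\mathbb R^M$, $\mathrm H\{f\}=(\langle h_1,f\rangle,\dots,\langle h_M,f\rangle)$, be linear and bounded for the norm $\big(\|\mathrm Lf\|_{L_2}^2+\sum_n\langle\kappa_n,f\rangle^2\big)^{1/2}$, where $\kappa_1,\dots,\kappa_{N_0}$ are real Schwartz functions with $\langle\kappa_j,p_i\rangle=\delta_{ij}$; here the $h_m$ are tempered distributions, and $\langle h_m,\cdot\rangle$ also denotes the extension to $\mathcal X_2$ of the pairing of $h_m$ with real Schwartz functions. Assume that $\mathrm H\{p\}=\mathrm H\{q\}\Leftrightarrow p=q$ for $p,q\in\mathcal N_{\mathrm L}$. Let $\lambda>0$, $\mathbf z\in\mathbb R^M$ and $E:\mathbb R^M\times\mathbb R^M\to[0,\infty]$ be such that $E(\mathbf z,\cdot)$ is convex, lower semicontinuous and coercive ($E(\mathbf z,\mathbf u)\to\infty$ as $\|\mathbf u\|\to\infty$), and $E(\mathbf z,\mathrm H\{f\})<\infty$ for at least one $f\in\mathcal X_2$. **Basis functions.** For each $m$ there is a real $\varphi_m\in\mathcal S'(\mathbb R)$, $$\varphi_m=\mathcal F^{-1}\Big\{\frac{\widehat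 h_m}{|\widehat{\mathrm L}|^2}\Big\}=(\mathrm L^*\mathrm L)^{-1}h_m=\rho*h_m ,$$ which means: $|\widehat{\mathrm L}|^2\,\widehat\varphi_m=\widehat h_m$ and $\mathrm L^*\mathrm L\varphi_m=h_m$, and, for every real Schwartz function $\psi$ with $\langle p,\psi\rangle=0$ for all $p\in\mathcal N_{\mathrm L}$, the function $\rho^\vee*\psi=\int_{\mathbb R}\rho(x-\cdot)\psi(x)\,\mathrm dx$ lies in $\mathcal X_2$ and $\langle\varphi_m,\psi\rangle=\langle h_m,\rho^\vee*\psi\rangle$. (This determines $\varphi_m$ up to an element of $\mathcal N_{\mathrm L}$.) **Theorem.** The functional $$J(f)=E(\mathbf z,\mathrm H\{f\})+\lambda\|\mathrm Lf\|_{L_2}^2$$ has a minimizer over $\mathcal X_2$; if $E(\mathbf z,\cdot)$ is strictly convex on its effective domain $\{\mathbf u : E(\mathbf z,\mathbf u)<\infty\}$, the minimizer is unique. For every choice of the $\varphi_m$ as above, every minimizer $f_2$ has the form $$f_2=\sum_{m=1}^M a_m\varphi_m+\sum_{n=1}^{N_0}b_np_n,\qquad a_m,b_n\in\mathbb R,$$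 with coefficients such that $\sum_{m=1}^M a_m\langle h_m,p_n\rangle=0$ for every $n\in\{1,\dots,N_0\}$. -/

import Mathlib

open scoped SchwartzMap FourierTransform ENNReal

noncomputable section

namespace Tikhonov

open MeasureTheory Filter Topology

/-- A Schwartz function is real-valued. -/
def IsRealTest (ψ : 𝓢(ℝ, ℂ)) : Prop := ∀ x, (ψ x).im = 0

/-- A tempered distribution is real: it takes real values on real-valued Schwartz functions. -/
def IsReal (f : 𝓢'(ℝ, ℂ)) : Prop := ∀ ψ : 𝓢(ℝ, ℂ), IsRealTest ψ → (f ψ).im = 0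

/-- The shift `f ↦ f(· - t)` on tempered distributions: `⟨f(· - t), ψ⟩ = ⟨f, ψ(· + t)⟩`. -/
def shift (t : ℝ) : 𝓢'(ℝ, ℂ) →L[ℂ] 𝓢'(ℝ, ℂ) :=
  PointwiseConvergenceCLM.precomp ℂ (SchwartzMap.compSubConstCLM ℂ (-t))

/-- The reflection `f ↦ f(-·)` on tempered distributions. -/
def reflect : 𝓢'(ℝ, ℂ) →L[ℂ] 𝓢'(ℝ, ℂ) :=
  PointwiseConvergenceCLM.precomp ℂ
    (SchwartzMap.compCLMOfContinuousLinearEquiv ℂ (ContinuousLinearEquiv.neg ℝ))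

theorem shift_apply (t : ℝ) (f : 𝓢'(ℝ, ℂ)) (ψ : 𝓢(ℝ, ℂ)) :
    shift t f ψ = f (SchwartzMap.compSubConstCLM ℂ (-t) ψ) := rfl

theorem reflect_apply (f : 𝓢'(ℝ, ℂ)) (ψ : 𝓢(ℝ, ℂ)) :
    reflect f ψ =
      f (SchwartzMap.compCLMOfContinuousLinearEquiv ℂ (ContinuousLinearEquiv.neg ℝ) ψ) := rfl

/-- The complex exponential `x ↦ e^{2πiξx}`, as a tempered distribution. -/
def cexp (ξ : ℝ) : 𝓢'(ℝ, ℂ) := 𝓕⁻ (TemperedDistribution.delta ξ)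

theorem cexp_apply (ξ : ℝ) (ψ : 𝓢(ℝ, ℂ)) :
    cexp ξ ψ = ∫ x : ℝ, Complex.exp (2 * Real.pi * Complex.I * ξ * x) * ψ x := by
  change (𝓕⁻ ψ) ξ = _
  rw [SchwartzMap.fourierInv_coe, Real.fourierInv_eq]
  refine integral_congr_ae (Eventually.of_forall fun x => ?_)
  simp only [Circle.smul_def, Real.fourierChar_apply, smul_eq_mul]
  congr 2
  simp
  ring

/-- The extended `L₂` norm of a tempered distribution: the `L₂` norm of the (unique) element of
`L₂(ℝ)` that represents it, and `∞` if there is none. -/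
def l2Norm (u : 𝓢'(ℝ, ℂ)) : ℝ≥0∞ :=
  ⨅ (w : Lp ℂ 2 (volume : Measure ℝ)) (_ : (w : 𝓢'(ℝ, ℂ)) = u), ‖w‖ₑ

theorem l2Norm_lt_top_iff (u : 𝓢'(ℝ, ℂ)) :
    l2Norm u < ⊤ ↔ ∃ w : Lp ℂ 2 (volume : Measure ℝ), (w : 𝓢'(ℝ, ℂ)) = u := by
  simp [l2Norm, iInf_lt_iff]

/-- The search space `X₂ = {f real | ‖Lf‖_{L₂} < ∞}`. -/
def X2 (L : 𝓢'(ℝ, ℂ) →L[ℂ] 𝓢'(ℝ, ℂ)) : Submodule ℝ 𝓢'(ℝ, ℂ) where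
  carrier := {f | IsReal f ∧ l2Norm (L f) < ⊤}
  zero_mem' := ⟨fun _ _ => by simp,
    (l2Norm_lt_top_iff _).2 ⟨0, by
      rw [map_zero, ← Lp.toTemperedDistributionCLM_apply, map_zero]⟩⟩
  add_mem' := by
    rintro f g ⟨hf, hf'⟩ ⟨hg, hg'⟩
    obtain ⟨v, hv⟩ := (l2Norm_lt_top_iff _).1 hf'
    obtain ⟨w, hw⟩ := (l2Norm_lt_top_iff _).1 hg'
    refine ⟨fun ψ hψ => by simp [hf ψ hψ, hg ψ hψ], (l2Norm_lt_top_iff _).2 ⟨v + w, ?_⟩⟩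
    rw [map_add, ← hv, ← hw, ← Lp.toTemperedDistributionCLM_apply, map_add]
    rfl
  smul_mem' := by
    rintro c f ⟨hf, hf'⟩
    obtain ⟨v, hv⟩ := (l2Norm_lt_top_iff _).1 hf'
    have hc : c • f = (c : ℂ) • f := by ext ψ; simp
    refine ⟨fun ψ hψ => by simp [hf ψ hψ], (l2Norm_lt_top_iff _).2 ⟨(c : ℂ) • v, ?_⟩⟩
    rw [hc, map_smul, ← hv, ← Lp.toTemperedDistributionCLM_apply, map_smul]
    rfl

/-- The null space `N_L = {p ∈ X₂ | Lp = 0}`. -/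
def nullSpace (L : 𝓢'(ℝ, ℂ) →L[ℂ] 𝓢'(ℝ, ℂ)) : Submodule ℝ (X2 L) where
  carrier := {p | L p = 0}
  zero_mem' := by simp
  add_mem' := by
    intro p q (hp : L p = 0) (hq : L q = 0)
    change L ((p + q : X2 L) : 𝓢'(ℝ, ℂ)) = 0
    rw [Submodule.coe_add, map_add, hp, hq, add_zero]
  smul_mem' := by
    intro c p (hp : L p = 0)
    change L ((c • p : X2 L) : 𝓢'(ℝ, ℂ)) = 0
    have hc : ((c • p : X2 L) : 𝓢'(ℝ, ℂ)) = (c : ℂ) • (p : 𝓢'(ℝ, ℂ)) := by ext ψ; simp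
    rw [hc, map_smul, hp]
    ext ψ
    simp

/-- Spline-admissible operators on tempered distributions. -/
structure SplineAdmissible (L : 𝓢'(ℝ, ℂ) →L[ℂ] 𝓢'(ℝ, ℂ)) : Prop where
  /-- `L` maps real distributions to real distributions. -/
  real : ∀ f, IsReal f → IsReal (L f)
  shift_invariant : ∀ t f, L (shift t f) = shift t (L f)
  finite_nullSpace : FiniteDimensional ℝ (nullSpace L)
  exists_green : ∃ ρ, IsReal ρ ∧ L ρ = TemperedDistribution.delta 0

/-- The adjoint `L*` of a real shift-invariant operator: if `L` is the convolution with `k`, then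
`L*` is the convolution with `k(-·)`. -/
def adjoint (L : 𝓢'(ℝ, ℂ) →L[ℂ] 𝓢'(ℝ, ℂ)) : 𝓢'(ℝ, ℂ) →L[ℂ] 𝓢'(ℝ, ℂ) :=
  reflect ∘L L ∘L reflect

/-- `ρ` is a (real) Green's function of `L*L`. -/
def IsGreenAdjointSelf (L : 𝓢'(ℝ, ℂ) →L[ℂ] 𝓢'(ℝ, ℂ)) (ρ : 𝓢'(ℝ, ℂ)) : Prop :=
  IsReal ρ ∧ adjoint L (L ρ) = TemperedDistribution.delta 0

/-- `Lhat` is the frequency response of `L`: `L{e^{2πiξ·}} = Lhat(ξ) e^{2πiξ·}`. -/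
def IsFrequencyResponse (L : 𝓢'(ℝ, ℂ) →L[ℂ] 𝓢'(ℝ, ℂ)) (Lhat : ℝ → ℂ) : Prop :=
  ∀ ξ, L (cexp ξ) = Lhat ξ • cexp ξ

/-- The identity `g · u = v` between tempered distributions `u`, `v`, where `g` is a function that
maps Schwartz functions to Schwartz functions by multiplication: `⟨u, g ψ⟩ = ⟨v, ψ⟩`. -/
def MulEq (g : ℝ → ℂ) (u v : 𝓢'(ℝ, ℂ)) : Prop :=
  ∀ ψ : 𝓢(ℝ, ℂ), ∃ θ : 𝓢(ℝ, ℂ), (∀ ξ, θ ξ = g ξ * ψ ξ) ∧ u θ = v ψ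

/-- The Hilbert norm `(‖Lf‖² + ∑ₙ ⟨κₙ, f⟩²)^{1/2}` of `X₂`, for a system of Schwartz functions
`κ` biorthonormal to a basis of the null space. -/
def nativeNorm (L : 𝓢'(ℝ, ℂ) →L[ℂ] 𝓢'(ℝ, ℂ)) {N₀ : ℕ} (κ : Fin N₀ → 𝓢(ℝ, ℂ)) (f : X2 L) : ℝ :=
  √((l2Norm (L f)).toReal ^ 2 + ∑ n, (((f : 𝓢'(ℝ, ℂ)) (κ n)).re) ^ 2)

/-- Boundedness of `H : X₂ → ℝ^M`. -/
def IsBoundedMeasurement {L : 𝓢'(ℝ, ℂ) →L[ℂ] 𝓢'(ℝ, ℂ)} {N₀ M : ℕ}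
    (p : Module.Basis (Fin N₀) ℝ (nullSpace L)) (H : X2 L →ₗ[ℝ] (Fin M → ℝ)) : Prop :=
  ∃ κ : Fin N₀ → 𝓢(ℝ, ℂ), (∀ n, IsRealTest (κ n)) ∧
    (∀ i j, ((p i : X2 L) : 𝓢'(ℝ, ℂ)) (κ j) = if i = j then 1 else 0) ∧
    ∃ C : ℝ, ∀ f, ‖H f‖ ≤ C * nativeNorm L κ f

/-- The `m`-th component of `H` is the pairing with the distribution `h m`:
`H{ψ}ₘ = ⟨hₘ, ψ⟩` for (real) Schwartz functions `ψ`. -/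
def IsGivenBy {L : 𝓢'(ℝ, ℂ) →L[ℂ] 𝓢'(ℝ, ℂ)} {M : ℕ}
    (H : X2 L →ₗ[ℝ] (Fin M → ℝ)) (h : Fin M → 𝓢'(ℝ, ℂ)) : Prop :=
  ∀ (m : Fin M) (ψ : 𝓢(ℝ, ℂ)), IsRealTest ψ →
    ∀ hψ : (ψ : 𝓢'(ℝ, ℂ)) ∈ X2 L, h m ψ = (H ⟨ψ, hψ⟩ m : ℂ)

/-- The function `y ↦ ∫ ρ(x - y) ψ(x) dx`, as a tempered distribution; its Fourier transform is the
product of those of `ψ` and of `ρ(-·)`. -/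
def correlate (ρ : 𝓢'(ℝ, ℂ)) (ψ : 𝓢(ℝ, ℂ)) : 𝓢'(ℝ, ℂ) :=
  𝓕⁻ (TemperedDistribution.smulLeftCLM ℂ (𝓕 ψ : 𝓢(ℝ, ℂ)) (𝓕⁻ ρ))

/-- `φ = ℱ⁻¹{ĥ / |Lhat|²} = (L*L)⁻¹ h`, where `h` is a distribution that extends to the
functional `hX` on `X₂`, and `ρ` is the Green's function of `L*L`. Since `Lhat` may vanish, the
quotient is the solution `φ = ρ * h` of `|Lhat|² φ̂ = ĥ`, where the convolution is defined by
duality, `⟨ρ * h, ψ⟩ = ⟨h, ∫ ρ(x - ·) ψ(x) dx⟩`, for the Schwartz functions `ψ` that are orthogonal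
to the null space (for those, the right-hand side is the pairing of `h` with an element of `X₂`).
This determines `φ` up to an element of the null space. -/
structure IsBasisFunction (L : 𝓢'(ℝ, ℂ) →L[ℂ] 𝓢'(ℝ, ℂ)) (Lhat : ℝ → ℂ) (ρ : 𝓢'(ℝ, ℂ))
    (h : 𝓢'(ℝ, ℂ)) (hX : X2 L → ℝ) (φ : 𝓢'(ℝ, ℂ)) : Prop where
  real : IsReal φ
  fourier : MulEq (fun ξ => ((‖Lhat ξ‖ ^ 2 : ℝ) : ℂ)) (𝓕 φ) (𝓕 h)
  inverse : adjoint L (L φ) = h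
  convolution : ∀ ψ : 𝓢(ℝ, ℂ), IsRealTest ψ →
    (∀ q : nullSpace L, ((q : X2 L) : 𝓢'(ℝ, ℂ)) ψ = 0) →
    ∃ hψ : correlate ρ ψ ∈ X2 L, φ ψ = (hX ⟨correlate ρ ψ, hψ⟩ : ℂ)

/-- Convexity of an extended-valued function. -/
def IsConvex {M : ℕ} (F : (Fin M → ℝ) → ℝ≥0∞) : Prop :=
  ∀ u v (s t : ℝ), 0 < s → 0 < t → s + t = 1 →
    F (s • u + t • v) ≤ ENNReal.ofReal s * F u + ENNReal.ofReal t * F v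

/-- Strict convexity of an extended-valued function, on its effective domain. -/
def IsStrictlyConvex {M : ℕ} (F : (Fin M → ℝ) → ℝ≥0∞) : Prop :=
  ∀ u v, u ≠ v → F u ≠ ⊤ → F v ≠ ⊤ → ∀ s t : ℝ, 0 < s → 0 < t → s + t = 1 →
    F (s • u + t • v) < ENNReal.ofReal s * F u + ENNReal.ofReal t * F v

/-- Coercivity: `F u → ∞` as `‖u‖ → ∞`. -/
def IsCoercive {M : ℕ} (F : (Fin M → ℝ) → ℝ≥0∞) : Prop :=
  Tendsto F (cocompact (Fin M → ℝ)) (𝓝 ⊤)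

/-- The cost `E(z, H{f}) + lam ‖Lf‖²`. -/
def cost {M : ℕ} (L : 𝓢'(ℝ, ℂ) →L[ℂ] 𝓢'(ℝ, ℂ)) (H : X2 L →ₗ[ℝ] (Fin M → ℝ))
    (E : (Fin M → ℝ) → (Fin M → ℝ) → ℝ≥0∞) (z : Fin M → ℝ) (lam : ℝ) (f : X2 L) : ℝ≥0∞ :=
  E z (H f) + ENNReal.ofReal lam * l2Norm (L f) ^ 2

/-- `f` minimizes `J` over `X₂`. -/
def IsMinimizer {L : 𝓢'(ℝ, ℂ) →L[ℂ] 𝓢'(ℝ, ℂ)} (J : X2 L → ℝ≥0∞) (f : X2 L) : Prop :=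
  ∀ g, J f ≤ J g

end Tikhonov

end

open Tikhonov

/-!
The key estimate is `‖η‖² = ⟨ρ^∨ * ψ, ψ⟩` for real `ψ = L^T η`, where `L^T` is the transpose of `L`
on Schwartz functions: it makes `L^T η ↦ η ∈ L₂` well defined and continuous for the Schwartz
topology. Extending `L^T η ↦ ⟨v, η⟩` by Hahn-Banach solves `L f = v` for every `v ∈ L₂`, and
extending `L^T η ↦ η` by density to all `ψ` orthogonal to the null space gives `L (ρ^∨ * ψ) ∈ L₂`
together with `⟨f, ψ⟩ = ⟪L f, L (ρ^∨ * ψ)⟫`. So, for `κ` biorthonormal to a null space basis,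
`f ↦ (L f, ⟨κ, f⟩)` identifies the search space with a Hilbert space, and the Riesz representation
of `h` there yields `ρ * h`.

In these coordinates `J` is a Tikhonov functional with finitely many measurements. A minimizer
exists because only the component of `L f` orthogonal to a subspace of finite codimension matters.
At a minimizer `f`, the form `⟪L f, L ·⟫` vanishes on the kernel of `H`, so it equals `∑ aₘ Hₘ`.
Evaluating it at `ρ^∨ * ψ` gives `⟨f - ∑ aₘ φₘ, ψ⟩ = 0` for all `ψ` orthogonal to the null space,
which leaves an element of the null space, and evaluating it at `pₙ` gives the condition on `a`.
-/

noncomputable section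

namespace Tikhonov

open MeasureTheory Filter Topology

/-! ### Conjugation and reflection -/

section Conjugation

/-- The pointwise complex conjugate of a Schwartz function, whose fixed points are the real Schwartz
functions. -/
def conjTest : 𝓢(ℝ, ℂ) →L[ℝ] 𝓢(ℝ, ℂ) :=
  SchwartzMap.postcompCLM (𝕜 := ℝ) (Complex.conjCLE : ℂ →L[ℝ] ℂ)

@[simp]
theorem conjTest_apply (ψ : 𝓢(ℝ, ℂ)) (x : ℝ) : conjTest ψ x = starRingEnd ℂ (ψ x) := rfl

@[simp]
theorem conjTest_conjTest (ψ : 𝓢(ℝ, ℂ)) : conjTest (conjTest ψ) = ψ := by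
  ext x; simp

theorem conjTest_smul (c : ℂ) (ψ : 𝓢(ℝ, ℂ)) :
    conjTest (c • ψ) = starRingEnd ℂ c • conjTest ψ := by
  ext x; simp

theorem isRealTest_iff_conjTest_eq {ψ : 𝓢(ℝ, ℂ)} : IsRealTest ψ ↔ conjTest ψ = ψ := by
  simp only [IsRealTest, SchwartzMap.ext_iff, conjTest_apply, Complex.conj_eq_iff_im]

/-- The real part of a Schwartz function, as a complex-valued Schwartz function: identities that are
linear in a Schwartz function reduce to real ones. -/
def reTest (ψ : 𝓢(ℝ, ℂ)) : 𝓢(ℝ, ℂ) := (1 / 2 : ℂ) • (ψ + conjTest ψ)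

theorem isRealTest_reTest (ψ : 𝓢(ℝ, ℂ)) : IsRealTest (reTest ψ) := fun x => by simp [reTest]

theorem reTest_add_I_smul_reTest (ψ : 𝓢(ℝ, ℂ)) :
    reTest ψ + Complex.I • reTest (-Complex.I • ψ) = ψ := by
  ext x
  simp only [reTest, conjTest_smul, add_apply, smul_apply, smul_eq_mul, map_neg, Complex.conj_I]
  linear_combination (-(1 / 2) * (ψ x - conjTest ψ x)) * Complex.I_sq

theorem ext_of_isRealTest {f g : 𝓢'(ℝ, ℂ)} (h : ∀ ψ, IsRealTest ψ → f ψ = g ψ) : f = g := by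
  ext ψ
  rw [← reTest_add_I_smul_reTest ψ]
  simp only [map_add, map_smul, h _ (isRealTest_reTest _)]

theorem IsReal.coe_re_apply {f : 𝓢'(ℝ, ℂ)} (hf : IsReal f) {ψ : 𝓢(ℝ, ℂ)} (hψ : IsRealTest ψ) :
    ((f ψ).re : ℂ) = f ψ :=
  Complex.ext rfl (hf ψ hψ).symm

/-- The complex conjugate of a tempered distribution, whose fixed points are the real
distributions. -/
def conjDist (f : 𝓢'(ℝ, ℂ)) : 𝓢'(ℝ, ℂ) :=
  ContinuousLinearMap.toPointwiseConvergenceCLM ℂ (RingHom.id ℂ) 𝓢(ℝ, ℂ) ℂ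
    { toFun := fun ψ => starRingEnd ℂ (f (conjTest ψ))
      map_add' := fun ψ χ => by simp
      map_smul' := fun c ψ => by simp [conjTest_smul]
      cont := Complex.continuous_conj.comp ((map_continuous f).comp conjTest.continuous) }

@[simp]
theorem conjDist_apply (f : 𝓢'(ℝ, ℂ)) (ψ : 𝓢(ℝ, ℂ)) :
    conjDist f ψ = starRingEnd ℂ (f (conjTest ψ)) := rfl

theorem isReal_iff_conjDist_eq {f : 𝓢'(ℝ, ℂ)} : IsReal f ↔ conjDist f = f := by
  refine ⟨fun hf => ext_of_isRealTest fun ψ hψ => ?_, fun hf ψ hψ => ?_⟩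
  · rw [conjDist_apply, isRealTest_iff_conjTest_eq.1 hψ, Complex.conj_eq_iff_im.2 (hf ψ hψ)]
  · rw [← Complex.conj_eq_iff_im]
    conv_rhs => rw [← hf, conjDist_apply, isRealTest_iff_conjTest_eq.1 hψ]

theorem IsReal.apply_conjTest {f : 𝓢'(ℝ, ℂ)} (hf : IsReal f) (ψ : 𝓢(ℝ, ℂ)) :
    f (conjTest ψ) = starRingEnd ℂ (f ψ) := by
  rw [← Complex.conj_conj (f (conjTest ψ)), ← conjDist_apply, isReal_iff_conjDist_eq.1 hf]

/-- The real part of a tempered distribution, as a tempered distribution: it turns a solution of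
`L f = v` with real `v` into a real one. -/
def reDist (f : 𝓢'(ℝ, ℂ)) : 𝓢'(ℝ, ℂ) := (1 / 2 : ℂ) • (f + conjDist f)

theorem reDist_apply (f : 𝓢'(ℝ, ℂ)) (ψ : 𝓢(ℝ, ℂ)) :
    reDist f ψ = (1 / 2 : ℂ) * (f ψ + conjDist f ψ) := rfl

theorem isReal_reDist (f : 𝓢'(ℝ, ℂ)) : IsReal (reDist f) := fun ψ hψ => by
  simp [reDist_apply, isRealTest_iff_conjTest_eq.1 hψ]

theorem IsReal.reDist_eq {f : 𝓢'(ℝ, ℂ)} (hf : IsReal f) : reDist f = f := by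
  ext ψ
  rw [reDist_apply, isReal_iff_conjDist_eq.1 hf]
  ring

theorem reDist_add_I_smul_reDist (f : 𝓢'(ℝ, ℂ)) :
    reDist f + Complex.I • reDist (-Complex.I • f) = f := by
  ext ψ
  change reDist f ψ + Complex.I * reDist (-Complex.I • f) ψ = f ψ
  have hconj : conjDist (-Complex.I • f) ψ = Complex.I * conjDist f ψ := by simp
  have hsmul : (-Complex.I • f) ψ = -Complex.I * f ψ := rfl
  rw [reDist_apply, reDist_apply, hconj, hsmul]
  linear_combination (-(1 / 2) * (f ψ - conjDist f ψ)) * Complex.I_sq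

/-- The reflection `ψ ↦ ψ(-·)` of Schwartz functions, the transpose of `reflect`. -/
def reflectTest : 𝓢(ℝ, ℂ) →L[ℂ] 𝓢(ℝ, ℂ) :=
  SchwartzMap.compCLMOfContinuousLinearEquiv ℂ (ContinuousLinearEquiv.neg ℝ)

theorem reflectTest_apply (ψ : 𝓢(ℝ, ℂ)) (x : ℝ) : reflectTest ψ x = ψ (-x) := rfl

theorem isRealTest_reflectTest {ψ : 𝓢(ℝ, ℂ)} (hψ : IsRealTest ψ) : IsRealTest (reflectTest ψ) :=
  fun x => hψ (-x)

theorem fourierInv_apply_eq_fourier_neg (ψ : 𝓢(ℝ, ℂ)) (ξ : ℝ) : 𝓕⁻ ψ ξ = 𝓕 ψ (-ξ) := rfl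

theorem fourier_apply_eq_fourierInv_neg (ψ : 𝓢(ℝ, ℂ)) (ξ : ℝ) : 𝓕 ψ ξ = 𝓕⁻ ψ (-ξ) := by
  rw [fourierInv_apply_eq_fourier_neg, neg_neg]

theorem fourier_reflectTest_apply (ψ : 𝓢(ℝ, ℂ)) (ξ : ℝ) : 𝓕 (reflectTest ψ) ξ = 𝓕⁻ ψ ξ := by
  rw [SchwartzMap.fourier_coe, SchwartzMap.fourierInv_coe, Real.fourier_eq, Real.fourierInv_eq,
    ← integral_neg_eq_self]
  simp [reflectTest_apply]

theorem fourier_conjTest_apply (ψ : 𝓢(ℝ, ℂ)) (ξ : ℝ) :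
    𝓕 (conjTest ψ) ξ = starRingEnd ℂ (𝓕⁻ ψ ξ) := by
  rw [SchwartzMap.fourier_coe, SchwartzMap.fourierInv_coe, Real.fourier_eq, Real.fourierInv_eq,
    ← integral_conj]
  refine integral_congr_ae (Eventually.of_forall fun x => ?_)
  simp [Circle.smul_def, Real.fourierChar_apply, ← Complex.exp_conj, Complex.conj_ofNat]

theorem fourierInv_conjTest_apply (ψ : 𝓢(ℝ, ℂ)) (ξ : ℝ) :
    𝓕⁻ (conjTest ψ) ξ = starRingEnd ℂ (𝓕 ψ ξ) := by
  rw [fourierInv_apply_eq_fourier_neg, fourier_conjTest_apply, ← fourier_apply_eq_fourierInv_neg]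

theorem ext_of_fourier_apply_eq {ψ χ : 𝓢(ℝ, ℂ)} (h : ∀ ξ, 𝓕 ψ ξ = 𝓕 χ ξ) : ψ = χ := by
  have hinv : 𝓕⁻ (𝓕 ψ) = 𝓕⁻ (𝓕 χ) := congrArg _ (SchwartzMap.ext h)
  rwa [FourierTransform.fourierInv_fourier_eq, FourierTransform.fourierInv_fourier_eq] at hinv

end Conjugation

/-! ### Joint continuity of pairings of Schwartz functions -/

section Pairing

variable {D E F G : Type*} [NormedAddCommGroup D] [NormedSpace ℝ D]
  [NormedAddCommGroup E] [NormedSpace ℝ E] [NormedAddCommGroup F] [NormedSpace ℝ F]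
  [NormedAddCommGroup G] [NormedSpace ℝ G]

theorem seminorm_pairing_le (B : E →L[ℝ] F →L[ℝ] G) (k n : ℕ) (ψ : 𝓢(D, E)) (χ : 𝓢(D, F)) :
    SchwartzMap.seminorm ℝ k n (SchwartzMap.pairing B ψ χ) ≤
      ‖B‖ * ∑ i ∈ Finset.range (n + 1), (n.choose i : ℝ) *
        SchwartzMap.seminorm ℝ k i ψ * SchwartzMap.seminorm ℝ 0 (n - i) χ := by
  refine SchwartzMap.seminorm_le_bound ℝ k n _ (by positivity) fun x => ?_
  calc ‖x‖ ^ k * ‖iteratedFDeriv ℝ n (SchwartzMap.pairing B ψ χ) x‖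
      ≤ ‖x‖ ^ k * (‖B‖ * ∑ i ∈ Finset.range (n + 1), (n.choose i : ℝ) *
          ‖iteratedFDeriv ℝ i ψ x‖ * ‖iteratedFDeriv ℝ (n - i) χ x‖) := by
        gcongr
        exact B.norm_iteratedFDeriv_le_of_bilinear (ψ.smooth n) (χ.smooth n) x le_rfl
    _ = ‖B‖ * ∑ i ∈ Finset.range (n + 1), (n.choose i : ℝ) *
          (‖x‖ ^ k * ‖iteratedFDeriv ℝ i ψ x‖) * ‖iteratedFDeriv ℝ (n - i) χ x‖ := by
        rw [mul_left_comm, Finset.mul_sum]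
        congr 2 with i
        ring
    _ ≤ _ := by
        gcongr with i
        · exact SchwartzMap.le_seminorm ℝ k i ψ x
        · exact SchwartzMap.norm_iteratedFDeriv_le_seminorm ℝ χ (n - i) x

theorem continuousAt_pairing_zero (B : E →L[ℝ] F →L[ℝ] G) :
    ContinuousAt (fun x : 𝓢(D, E) × 𝓢(D, F) => SchwartzMap.pairing B x.1 x.2) 0 := by
  rw [ContinuousAt, (schwartz_withSeminorms ℝ D G).tendsto_nhds]
  rintro ⟨k, n⟩ ε hε
  have hleft (i : ℕ) : Continuous (SchwartzMap.seminorm ℝ k i : Seminorm ℝ 𝓢(D, E)) :=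
    (schwartz_withSeminorms ℝ D E).continuous_seminorm (k, i)
  have hright (i : ℕ) : Continuous (SchwartzMap.seminorm ℝ 0 i : Seminorm ℝ 𝓢(D, F)) :=
    (schwartz_withSeminorms ℝ D F).continuous_seminorm (0, i)
  have hbound : Continuous fun x : 𝓢(D, E) × 𝓢(D, F) => ‖B‖ * ∑ i ∈ Finset.range (n + 1),
      (n.choose i : ℝ) * SchwartzMap.seminorm ℝ k i x.1 * SchwartzMap.seminorm ℝ 0 (n - i) x.2 :=
    continuous_const.mul <| continuous_finsetSum _ fun i _ =>
      (continuous_const.mul ((hleft i).comp continuous_fst)).mul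
        ((hright (n - i)).comp continuous_snd)
  filter_upwards [hbound.continuousAt.eventually_lt continuousAt_const (by simpa using hε)]
    with x hx
  rw [Prod.fst_zero, Prod.snd_zero, map_zero, sub_zero]
  exact (seminorm_pairing_le B k n x.1 x.2).trans_lt hx

theorem continuous_pairing (B : E →L[ℝ] F →L[ℝ] G) :
    Continuous fun x : 𝓢(D, E) × 𝓢(D, F) => SchwartzMap.pairing B x.1 x.2 := by
  let pairingHom : 𝓢(D, E) →+ 𝓢(D, F) →+ 𝓢(D, G) :=
    AddMonoidHom.mk' (fun ψ => (SchwartzMap.pairing B ψ).toLinearMap.toAddMonoidHom)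
      fun ψ ψ' => by ext; simp
  exact continuous_of_continuousAt_zero₂ pairingHom (continuousAt_pairing_zero B)
    (fun ψ => (SchwartzMap.pairing B ψ).continuous.continuousAt)
    fun χ => (SchwartzMap.pairing_continuous_left B χ).continuousAt

end Pairing

/-! ### Correlations -/

section Correlation

/-- The correlation `x ↦ ∫ ψ(x + y) χ(y) dy` of two Schwartz functions, defined through its Fourier
transform. -/
def testCorrelation (ψ χ : 𝓢(ℝ, ℂ)) : 𝓢(ℝ, ℂ) :=
  𝓕⁻ (SchwartzMap.pairing (ContinuousLinearMap.mul ℝ ℂ) (𝓕 ψ) (𝓕⁻ χ))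

@[simp]
theorem fourier_testCorrelation_apply (ψ χ : 𝓢(ℝ, ℂ)) (ξ : ℝ) :
    𝓕 (testCorrelation ψ χ) ξ = 𝓕 ψ ξ * 𝓕⁻ χ ξ := by
  rw [testCorrelation, FourierTransform.fourier_fourierInv_eq]
  rfl

theorem continuous_testCorrelation :
    Continuous fun x : 𝓢(ℝ, ℂ) × 𝓢(ℝ, ℂ) => testCorrelation x.1 x.2 := by
  have hfourier : Continuous fun ψ : 𝓢(ℝ, ℂ) => 𝓕 ψ :=
    ContinuousFourier.continuous_fourier
  have hinv : Continuous fun ψ : 𝓢(ℝ, ℂ) => 𝓕⁻ ψ :=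
    ContinuousFourierInv.continuous_fourierInv
  have hpair : Continuous fun x : 𝓢(ℝ, ℂ) × 𝓢(ℝ, ℂ) => (𝓕 x.1, 𝓕⁻ x.2) :=
    (hfourier.comp continuous_fst).prodMk (hinv.comp continuous_snd)
  have hmul := (continuous_pairing (ContinuousLinearMap.mul ℝ ℂ)).comp hpair
  exact hinv.comp hmul

theorem testCorrelation_apply_zero (ψ χ : 𝓢(ℝ, ℂ)) : testCorrelation ψ χ 0 = ∫ x, χ x * ψ x := by
  rw [testCorrelation, SchwartzMap.fourierInv_coe, Real.fourierInv_eq]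
  simp only [inner_zero_right, AddChar.map_zero_eq_one, one_smul,
    SchwartzMap.pairing_apply_apply, ContinuousLinearMap.mul_apply']
  rw [SchwartzMap.integral_fourier_mul_eq, FourierTransform.fourier_fourierInv_eq]
  simp_rw [mul_comm]

theorem reflectTest_testCorrelation (ψ χ : 𝓢(ℝ, ℂ)) :
    reflectTest (testCorrelation ψ χ) = testCorrelation χ ψ := by
  refine ext_of_fourier_apply_eq fun ξ => ?_
  rw [fourier_reflectTest_apply, fourierInv_apply_eq_fourier_neg, fourier_testCorrelation_apply,
    fourier_testCorrelation_apply, ← fourierInv_apply_eq_fourier_neg,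
    ← fourier_apply_eq_fourierInv_neg, mul_comm]

theorem isRealTest_testCorrelation {ψ χ : 𝓢(ℝ, ℂ)} (hψ : IsRealTest ψ) (hχ : IsRealTest χ) :
    IsRealTest (testCorrelation ψ χ) := by
  rw [isRealTest_iff_conjTest_eq] at *
  refine ext_of_fourier_apply_eq fun ξ => ?_
  rw [fourier_conjTest_apply, fourierInv_apply_eq_fourier_neg, fourier_testCorrelation_apply,
    fourier_testCorrelation_apply, map_mul, ← fourierInv_apply_eq_fourier_neg,
    ← fourier_apply_eq_fourierInv_neg, ← fourier_conjTest_apply, ← fourierInv_conjTest_apply,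
    hψ, hχ]

theorem correlate_apply (ρ : 𝓢'(ℝ, ℂ)) (ψ χ : 𝓢(ℝ, ℂ)) :
    correlate ρ ψ χ = ρ (testCorrelation ψ χ) := by
  have hmul : SchwartzMap.smulLeftCLM ℂ (𝓕 ψ : 𝓢(ℝ, ℂ)) (𝓕⁻ χ) =
      SchwartzMap.pairing (ContinuousLinearMap.mul ℝ ℂ) (𝓕 ψ) (𝓕⁻ χ) := by
    ext ξ
    simp [(𝓕 ψ).hasTemperateGrowth]
  rw [testCorrelation, ← hmul]
  rfl

theorem correlate_reflect_apply (ρ : 𝓢'(ℝ, ℂ)) (ψ χ : 𝓢(ℝ, ℂ)) :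
    correlate (reflect ρ) χ ψ = correlate ρ ψ χ := by
  rw [correlate_apply, correlate_apply, ← reflectTest_testCorrelation χ ψ]
  rfl

theorem continuous_correlate_apply (ρ : 𝓢'(ℝ, ℂ)) :
    Continuous fun x : 𝓢(ℝ, ℂ) × 𝓢(ℝ, ℂ) => correlate ρ x.1 x.2 := by
  simp_rw [correlate_apply]
  exact (map_continuous ρ).comp continuous_testCorrelation

theorem isReal_correlate {ρ : 𝓢'(ℝ, ℂ)} (hρ : IsReal ρ) {ψ : 𝓢(ℝ, ℂ)} (hψ : IsRealTest ψ) :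
    IsReal (correlate ρ ψ) := fun χ hχ => by
  rw [correlate_apply]
  exact hρ _ (isRealTest_testCorrelation hψ hχ)

end Correlation

/-! ### The transpose of an operator on tempered distributions -/

section Transpose

theorem exists_eq_apply (u : 𝓢'(ℝ, ℂ) →L[ℂ] ℂ) : ∃ ψ : 𝓢(ℝ, ℂ), ∀ f, u f = f ψ := by
  obtain ⟨ψ, hψ⟩ := LinearMap.dualEmbedding_surjective (topDualPairing ℂ 𝓢(ℝ, ℂ))
    (u ∘L ((PointwiseConvergenceCLM.equivWeakDual ℂ 𝓢(ℝ, ℂ)).symm :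
      WeakDual ℂ 𝓢(ℝ, ℂ) →L[ℂ] 𝓢'(ℝ, ℂ)))
  exact ⟨ψ, fun f => (DFunLike.congr_fun hψ
    (PointwiseConvergenceCLM.equivWeakDual ℂ 𝓢(ℝ, ℂ) f)).symm⟩

theorem ext_of_apply_eq {ψ χ : 𝓢(ℝ, ℂ)} (h : ∀ f : 𝓢'(ℝ, ℂ), f ψ = f χ) : ψ = χ :=
  SchwartzMap.ext fun x => h (TemperedDistribution.delta x)

variable (L : 𝓢'(ℝ, ℂ) →L[ℂ] 𝓢'(ℝ, ℂ))

theorem exists_apply_eq_apply (ψ : 𝓢(ℝ, ℂ)) : ∃ χ : 𝓢(ℝ, ℂ), ∀ f, L f ψ = f χ :=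
  exists_eq_apply (PointwiseConvergenceCLM.evalCLM (RingHom.id ℂ) ℂ ψ ∘L L)

/-- The transpose of an operator on tempered distributions, acting on Schwartz functions. It exists
because the Schwartz functions are the continuous functionals on tempered distributions with the
topology of pointwise convergence. -/
def transpose : 𝓢(ℝ, ℂ) →ₗ[ℂ] 𝓢(ℝ, ℂ) where
  toFun ψ := (exists_apply_eq_apply L ψ).choose
  map_add' ψ χ := ext_of_apply_eq fun f => by
    rw [map_add, ← (exists_apply_eq_apply L (ψ + χ)).choose_spec,
      ← (exists_apply_eq_apply L ψ).choose_spec, ← (exists_apply_eq_apply L χ).choose_spec, map_add]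
  map_smul' c ψ := ext_of_apply_eq fun f => by
    rw [RingHom.id_apply, map_smul, ← (exists_apply_eq_apply L (c • ψ)).choose_spec,
      ← (exists_apply_eq_apply L ψ).choose_spec, map_smul]

theorem apply_transpose (f : 𝓢'(ℝ, ℂ)) (ψ : 𝓢(ℝ, ℂ)) : f (transpose L ψ) = L f ψ :=
  ((exists_apply_eq_apply L ψ).choose_spec f).symm

/-- The transpose of `adjoint L ∘L L`. -/
def normalTranspose (ψ : 𝓢(ℝ, ℂ)) : 𝓢(ℝ, ℂ) :=
  transpose L (reflectTest (transpose L (reflectTest ψ)))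

theorem apply_normalTranspose (f : 𝓢'(ℝ, ℂ)) (ψ : 𝓢(ℝ, ℂ)) :
    f (normalTranspose L ψ) = adjoint L (L f) ψ := by
  have hinner : L f (reflectTest (transpose L (reflectTest ψ))) =
      reflect (L f) (transpose L (reflectTest ψ)) := rfl
  rw [normalTranspose, apply_transpose, hinner, apply_transpose]
  rfl

/-- `L` maps real distributions to real distributions. -/
def PreservesReal : Prop := ∀ f, IsReal f → IsReal (L f)

variable {L} {Lhat : ℝ → ℂ} {ρ : 𝓢'(ℝ, ℂ)}

theorem transpose_conjTest (hL : PreservesReal L) (ψ : 𝓢(ℝ, ℂ)) :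
    transpose L (conjTest ψ) = conjTest (transpose L ψ) := by
  ext x
  have hδ : IsReal (TemperedDistribution.delta x : 𝓢'(ℝ, ℂ)) := fun ψ hψ => hψ x
  have hconj := (hL _ hδ).apply_conjTest ψ
  rwa [← apply_transpose, ← apply_transpose] at hconj

theorem map_conjDist (hL : PreservesReal L) (f : 𝓢'(ℝ, ℂ)) :
    L (conjDist f) = conjDist (L f) := by
  ext ψ
  rw [← apply_transpose, conjDist_apply, conjDist_apply, ← apply_transpose, transpose_conjTest hL]

theorem map_reDist (hL : PreservesReal L) (f : 𝓢'(ℝ, ℂ)) : L (reDist f) = reDist (L f) := by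
  rw [reDist, map_smul, map_add, map_conjDist hL, reDist]

theorem fourierInv_transpose_apply (hLhat : IsFrequencyResponse L Lhat) (ψ : 𝓢(ℝ, ℂ)) (ξ : ℝ) :
    𝓕⁻ (transpose L ψ) ξ = Lhat ξ * 𝓕⁻ ψ ξ := by
  have hcexp : L (cexp ξ) ψ = (Lhat ξ • cexp ξ) ψ := by rw [hLhat ξ]
  rwa [← apply_transpose] at hcexp

theorem fourier_transpose_apply (hLhat : IsFrequencyResponse L Lhat) (ψ : 𝓢(ℝ, ℂ)) (ξ : ℝ) :
    𝓕 (transpose L ψ) ξ = Lhat (-ξ) * 𝓕 ψ ξ := by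
  rw [fourier_apply_eq_fourierInv_neg, fourierInv_transpose_apply hLhat,
    ← fourier_apply_eq_fourierInv_neg]

theorem fourier_normalTranspose_apply (hLhat : IsFrequencyResponse L Lhat) (ψ : 𝓢(ℝ, ℂ)) (ξ : ℝ) :
    𝓕 (normalTranspose L ψ) ξ = Lhat ξ * Lhat (-ξ) * 𝓕 ψ ξ := by
  rw [normalTranspose, fourier_transpose_apply hLhat, fourier_reflectTest_apply,
    fourierInv_transpose_apply hLhat, fourierInv_apply_eq_fourier_neg, fourier_reflectTest_apply,
    ← fourier_apply_eq_fourierInv_neg]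
  ring

theorem frequencyResponse_mul_neg (hL : PreservesReal L) (hLhat : IsFrequencyResponse L Lhat)
    (ψ : 𝓢(ℝ, ℂ)) (ξ : ℝ) :
    Lhat ξ * Lhat (-ξ) * ψ ξ = ((‖Lhat ξ‖ ^ 2 : ℝ) : ℂ) * ψ ξ := by
  rcases eq_or_ne (ψ ξ) 0 with hψ | hψ
  · rw [hψ, mul_zero, mul_zero]
  have hcomm : 𝓕 (transpose L (conjTest (𝓕 ψ))) ξ = 𝓕 (conjTest (transpose L (𝓕 ψ))) ξ := by
    rw [transpose_conjTest hL]
  rw [fourier_transpose_apply hLhat, fourier_conjTest_apply, fourier_conjTest_apply,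
    fourierInv_transpose_apply hLhat, FourierTransform.fourierInv_fourier_eq, map_mul] at hcomm
  have hneg : Lhat (-ξ) = starRingEnd ℂ (Lhat ξ) :=
    mul_right_cancel₀ ((map_ne_zero (starRingEnd ℂ)).2 hψ) hcomm
  rw [hneg, Complex.mul_conj, Complex.normSq_eq_norm_sq]

theorem testCorrelation_transpose (hLhat : IsFrequencyResponse L Lhat) (ψ χ : 𝓢(ℝ, ℂ)) :
    testCorrelation (transpose L ψ) (transpose L χ) =
      normalTranspose L (testCorrelation ψ χ) := by
  refine ext_of_fourier_apply_eq fun ξ => ?_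
  rw [fourier_testCorrelation_apply, fourier_transpose_apply hLhat,
    fourierInv_transpose_apply hLhat, fourier_normalTranspose_apply hLhat,
    fourier_testCorrelation_apply]
  ring

theorem testCorrelation_normalTranspose (hLhat : IsFrequencyResponse L Lhat) (ψ χ : 𝓢(ℝ, ℂ)) :
    testCorrelation (normalTranspose L ψ) χ = normalTranspose L (testCorrelation ψ χ) := by
  refine ext_of_fourier_apply_eq fun ξ => ?_
  rw [fourier_testCorrelation_apply, fourier_normalTranspose_apply hLhat,
    fourier_normalTranspose_apply hLhat, fourier_testCorrelation_apply, mul_assoc]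

theorem green_apply_normalTranspose (hρ : IsGreenAdjointSelf L ρ) (ψ χ : 𝓢(ℝ, ℂ)) :
    ρ (normalTranspose L (testCorrelation ψ χ)) = (ψ : 𝓢'(ℝ, ℂ)) χ := by
  rw [apply_normalTranspose, hρ.2, TemperedDistribution.delta_apply, testCorrelation_apply_zero,
    SchwartzMap.coe_apply]
  rfl

theorem map_correlate_transpose (hLhat : IsFrequencyResponse L Lhat)
    (hρ : IsGreenAdjointSelf L ρ) (η : 𝓢(ℝ, ℂ)) :
    L (correlate ρ (transpose L η)) = (η : 𝓢'(ℝ, ℂ)) := by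
  ext ψ
  rw [← apply_transpose, correlate_apply, testCorrelation_transpose hLhat,
    green_apply_normalTranspose hρ]

theorem correlate_normalTranspose (hLhat : IsFrequencyResponse L Lhat)
    (hρ : IsGreenAdjointSelf L ρ) (ψ : 𝓢(ℝ, ℂ)) :
    correlate ρ (normalTranspose L ψ) = (ψ : 𝓢'(ℝ, ℂ)) := by
  ext χ
  rw [correlate_apply, testCorrelation_normalTranspose hLhat, green_apply_normalTranspose hρ]

end Transpose

/-! ### Schwartz functions orthogonal to the null space -/

section OrthNull

theorem mem_closure_of_forall_strongDual {𝕜 E : Type*} [RCLike 𝕜] [AddCommGroup E]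
    [TopologicalSpace E] [IsTopologicalAddGroup E] [Module 𝕜 E] [ContinuousSMul 𝕜 E] [Module ℝ E]
    [IsScalarTower ℝ 𝕜 E] [LocallyConvexSpace ℝ E] (S : Submodule 𝕜 E) {x : E}
    (hx : ∀ u : StrongDual 𝕜 E, (∀ y ∈ S, u y = 0) → u x = 0) : x ∈ closure (S : Set E) := by
  by_contra hmem
  have hconvex : Convex ℝ (closure (S : Set E)) := by
    have : ContinuousSMul ℝ E := IsScalarTower.continuousSMul 𝕜
    exact (S.restrictScalars ℝ).convex.closure
  obtain ⟨u, s, hS, hs⟩ :=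
    RCLike.geometric_hahn_banach_closed_point (𝕜 := 𝕜) hconvex isClosed_closure hmem
  have hpos : 0 < s := by simpa using hS 0 (subset_closure S.zero_mem)
  have hzero (y : E) (hy : y ∈ S) : u y = 0 := by
    by_contra hne
    have hlt := hS (((s : 𝕜) / u y) • y) (subset_closure (S.smul_mem _ hy))
    rw [map_smul, smul_eq_mul, div_mul_cancel₀ _ hne, RCLike.ofReal_re] at hlt
    exact hlt.false
  rw [hx u hzero, map_zero] at hs
  exact hpos.not_gt hs

variable {L : 𝓢'(ℝ, ℂ) →L[ℂ] 𝓢'(ℝ, ℂ)}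

variable (L) in
/-- The Schwartz functions orthogonal to the null space of `L`. -/
def orthNull : Submodule ℂ 𝓢(ℝ, ℂ) where
  carrier := {ψ | ∀ q : nullSpace L, ((q : X2 L) : 𝓢'(ℝ, ℂ)) ψ = 0}
  zero_mem' := fun q => map_zero _
  add_mem' := fun hψ hχ q => by rw [map_add, hψ q, hχ q, add_zero]
  smul_mem' := fun c ψ hψ q => by rw [map_smul, hψ q, smul_zero]

theorem transpose_mem_orthNull (η : 𝓢(ℝ, ℂ)) : transpose L η ∈ orthNull L := by
  intro q
  rw [apply_transpose, show L ((q : X2 L) : 𝓢'(ℝ, ℂ)) = 0 from q.2]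
  rfl

theorem apply_eq_zero_of_mem_orthNull {ψ : 𝓢(ℝ, ℂ)} (hψ : ψ ∈ orthNull L) {f : 𝓢'(ℝ, ℂ)}
    (hf : IsReal f) (hLf : L f = 0) : f ψ = 0 :=
  hψ ⟨⟨f, hf, by rw [hLf, ← map_zero L]; exact (X2 L).zero_mem.2⟩, hLf⟩

theorem orthNull_subset_closure_range_transpose (hL : PreservesReal L) :
    (orthNull L : Set 𝓢(ℝ, ℂ)) ⊆ closure (LinearMap.range (transpose L)) := by
  intro ψ hψ
  refine mem_closure_of_forall_strongDual _ fun u hu => ?_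
  let f : 𝓢'(ℝ, ℂ) := ContinuousLinearMap.toPointwiseConvergenceCLM ℂ (RingHom.id ℂ) 𝓢(ℝ, ℂ) ℂ u
  have hLf : L f = 0 := by
    ext η
    rw [← apply_transpose]
    exact hu _ ⟨η, rfl⟩
  have hre (c : ℂ) : reDist (c • f) ψ = 0 := by
    refine apply_eq_zero_of_mem_orthNull hψ (isReal_reDist _) ?_
    rw [map_reDist hL, map_smul, hLf]
    ext
    simp [reDist_apply]
  have hf : f ψ = reDist f ψ + Complex.I * reDist (-Complex.I • f) ψ := by
    conv_lhs => rw [← reDist_add_I_smul_reDist f]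
    rfl
  change f ψ = 0
  rw [hf, ← one_smul ℂ f, hre, smul_smul, hre, mul_zero, add_zero]

theorem denseRange_transpose (hL : PreservesReal L) :
    DenseRange fun η => (⟨transpose L η, transpose_mem_orthNull η⟩ : orthNull L) := by
  intro ψ
  rw [closure_subtype, ← Set.range_comp]
  exact orthNull_subset_closure_range_transpose hL ψ.2

end OrthNull

/-! ### Tempered distributions represented by square-integrable functions -/

section SquareIntegrable

theorem l2_ext {v w : ℝ →₂[volume] ℂ} (h : (v : 𝓢'(ℝ, ℂ)) = (w : 𝓢'(ℝ, ℂ))) : v = w :=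
  LinearMap.ker_eq_bot.1 (Lp.ker_toTemperedDistributionCLM_eq_bot (F := ℂ) (μ := volume) (p := 2)) h

theorem coe_l2_add (v w : ℝ →₂[volume] ℂ) :
    ((v + w : ℝ →₂[volume] ℂ) : 𝓢'(ℝ, ℂ)) = (v : 𝓢'(ℝ, ℂ)) + (w : 𝓢'(ℝ, ℂ)) :=
  map_add (Lp.toTemperedDistributionCLM ℂ volume 2) v w

theorem coe_l2_smul (c : ℂ) (v : ℝ →₂[volume] ℂ) :
    ((c • v : ℝ →₂[volume] ℂ) : 𝓢'(ℝ, ℂ)) = c • (v : 𝓢'(ℝ, ℂ)) :=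
  map_smul (Lp.toTemperedDistributionCLM ℂ volume 2) c v

theorem continuous_coe_l2_apply (χ : 𝓢(ℝ, ℂ)) :
    Continuous fun w : ℝ →₂[volume] ℂ => (w : 𝓢'(ℝ, ℂ)) χ :=
  (PointwiseConvergenceCLM.evalCLM (RingHom.id ℂ) ℂ χ ∘L
    Lp.toTemperedDistributionCLM ℂ volume 2).continuous

theorem l2Norm_coe (w : ℝ →₂[volume] ℂ) : l2Norm (w : 𝓢'(ℝ, ℂ)) = ‖w‖ₑ := by
  refine le_antisymm ?_ (le_iInf₂ fun v hv => ?_)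
  · exact iInf₂_le (f := fun (v : ℝ →₂[volume] ℂ)
      (_ : (v : 𝓢'(ℝ, ℂ)) = (w : 𝓢'(ℝ, ℂ))) => ‖v‖ₑ) w rfl
  · rw [l2_ext hv]

theorem inner_toLp_eq_apply {v : ℝ →₂[volume] ℂ} (hv : IsReal (v : 𝓢'(ℝ, ℂ)))
    (η : 𝓢(ℝ, ℂ)) : inner ℂ v (η.toLp 2 volume) = (v : 𝓢'(ℝ, ℂ)) η := by
  rw [← conjTest_conjTest η, hv.apply_conjTest, conjTest_conjTest, Lp.toTemperedDistribution_apply,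
    ← integral_conj, L2.inner_def]
  refine integral_congr_ae ?_
  filter_upwards [η.coeFn_toLp 2 volume] with x hx
  rw [hx]
  simp [mul_comm]

theorem norm_toLp_sq_eq_apply (η : 𝓢(ℝ, ℂ)) :
    ‖η.toLp 2 volume‖ ^ 2 = ((η : 𝓢'(ℝ, ℂ)) (conjTest η)).re := by
  rw [← inner_self_eq_norm_sq (𝕜 := ℂ), SchwartzMap.inner_toL2_toL2_eq η η volume,
    SchwartzMap.coe_apply]
  change (∫ x, inner ℂ (η x) (η x)).re = _
  congr 2
  ext x
  simp [mul_comm, Complex.mul_conj']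

end SquareIntegrable

/-! ### Solving `L f = v` for square-integrable `v` -/

section Surjectivity

variable {L : 𝓢'(ℝ, ℂ) →L[ℂ] 𝓢'(ℝ, ℂ)} {Lhat : ℝ → ℂ} {ρ : 𝓢'(ℝ, ℂ)}

theorem norm_toLp_eq_sqrt_correlate (hL : PreservesReal L) (hLhat : IsFrequencyResponse L Lhat)
    (hρ : IsGreenAdjointSelf L ρ) (η : 𝓢(ℝ, ℂ)) :
    ‖η.toLp 2 volume‖ = √(correlate ρ (transpose L η) (conjTest (transpose L η))).re := by
  rw [← transpose_conjTest hL, apply_transpose, map_correlate_transpose hLhat hρ,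
    ← norm_toLp_sq_eq_apply, Real.sqrt_sq (norm_nonneg _)]

theorem continuous_sqrt_correlate_conjTest (ρ : 𝓢'(ℝ, ℂ)) :
    Continuous fun ψ : 𝓢(ℝ, ℂ) => √(correlate ρ ψ (conjTest ψ)).re := by
  have hpair : Continuous fun ψ : 𝓢(ℝ, ℂ) => (ψ, conjTest ψ) :=
    continuous_id.prodMk conjTest.continuous
  have hcorrelate := (continuous_correlate_apply ρ).comp hpair
  exact Real.continuous_sqrt.comp (Complex.continuous_re.comp hcorrelate)

theorem transpose_injective (hL : PreservesReal L) (hLhat : IsFrequencyResponse L Lhat)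
    (hρ : IsGreenAdjointSelf L ρ) : Function.Injective (transpose L) := by
  refine (injective_iff_map_eq_zero _).2 fun η hη => ?_
  have hzero : η.toLp 2 volume = 0 := by
    rw [← norm_eq_zero, norm_toLp_eq_sqrt_correlate hL hLhat hρ, hη, map_zero, map_zero,
      Complex.zero_re, Real.sqrt_zero]
  exact (injective_iff_map_eq_zero (SchwartzMap.toLpCLM ℂ ℂ 2 volume)).1
    (SchwartzMap.injective_toLp 2 volume) η hzero

theorem exists_range_transpose_toLp (hL : PreservesReal L) (hLhat : IsFrequencyResponse L Lhat)
    (hρ : IsGreenAdjointSelf L ρ) :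
    ∃ S : LinearMap.range (transpose L) →L[ℂ] (ℝ →₂[volume] ℂ),
      ∀ η, S ⟨transpose L η, η, rfl⟩ = η.toLp 2 volume := by
  let e := LinearEquiv.ofInjective (transpose L) (transpose_injective hL hLhat hρ)
  let S : LinearMap.range (transpose L) →ₗ[ℂ] (ℝ →₂[volume] ℂ) :=
    (SchwartzMap.toLpCLM ℂ ℂ 2 volume).toLinearMap ∘ₗ e.symm.toLinearMap
  have hS (η : 𝓢(ℝ, ℂ)) : S ⟨transpose L η, η, rfl⟩ = η.toLp 2 volume :=
    congrArg (SchwartzMap.toLpCLM ℂ ℂ 2 volume) (e.symm_apply_apply η)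
  have hnorm (x : LinearMap.range (transpose L)) :
      ‖S x‖ = √(correlate ρ x (conjTest x)).re := by
    obtain ⟨_, η, rfl⟩ := x
    rw [hS, norm_toLp_eq_sqrt_correlate hL hLhat hρ]
  have hcont : ContinuousAt S 0 := by
    rw [ContinuousAt, map_zero, tendsto_zero_iff_norm_tendsto_zero]
    simp_rw [hnorm]
    have hlim := ((continuous_sqrt_correlate_conjTest ρ).comp
      (continuous_subtype_val (p := (· ∈ LinearMap.range (transpose L))))).tendsto 0
    simpa [Function.comp_def] using hlim
  exact ⟨⟨S, continuous_of_continuousAt_zero S hcont⟩, hS⟩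

theorem exists_orthNull_toLp (hL : PreservesReal L) (hLhat : IsFrequencyResponse L Lhat)
    (hρ : IsGreenAdjointSelf L ρ) :
    ∃ W : orthNull L →L[ℂ] (ℝ →₂[volume] ℂ),
      ∀ η, W ⟨transpose L η, transpose_mem_orthNull η⟩ = η.toLp 2 volume := by
  obtain ⟨S, hS⟩ := exists_range_transpose_toLp hL hLhat hρ
  have hle : LinearMap.range (transpose L) ≤ orthNull L := by
    rintro _ ⟨η, rfl⟩
    exact transpose_mem_orthNull η
  let e : LinearMap.range (transpose L) →L[ℂ] orthNull L :=
    ⟨Submodule.inclusion hle, continuous_inclusion hle⟩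
  have hdense : DenseRange e := (denseRange_transpose hL).mono <| by
    rintro _ ⟨η, rfl⟩
    exact ⟨⟨transpose L η, η, rfl⟩, rfl⟩
  have : IsUniformAddGroup (LinearMap.range (transpose L)) :=
    inferInstanceAs (IsUniformAddGroup (LinearMap.range (transpose L)).toAddSubgroup)
  have huniform : IsUniformInducing e := (isUniformEmbedding_set_inclusion hle).isUniformInducing
  exact ⟨S.extend e, fun η => (S.extend_eq hdense huniform _).trans (hS η)⟩

theorem coe_toLp_eq_map_correlate {W : orthNull L →L[ℂ] (ℝ →₂[volume] ℂ)} (hL : PreservesReal L)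
    (hLhat : IsFrequencyResponse L Lhat) (hρ : IsGreenAdjointSelf L ρ)
    (hW : ∀ η, W ⟨transpose L η, transpose_mem_orthNull η⟩ = η.toLp 2 volume)
    (ψ : orthNull L) : (W ψ : 𝓢'(ℝ, ℂ)) = L (correlate ρ ψ) := by
  ext χ
  rw [← apply_transpose]
  have hpair : Continuous fun ψ : orthNull L => ((ψ : 𝓢(ℝ, ℂ)), transpose L χ) :=
    continuous_subtype_val.prodMk continuous_const
  have hright := (continuous_correlate_apply ρ).comp hpair
  have hleft := (continuous_coe_l2_apply χ).comp W.continuous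
  refine (denseRange_transpose hL).induction_on
    (p := fun ψ : orthNull L => (W ψ : 𝓢'(ℝ, ℂ)) χ = correlate ρ ψ (transpose L χ)) ψ
    (isClosed_eq hleft hright) fun η => ?_
  rw [hW, apply_transpose, map_correlate_transpose hLhat hρ, Lp.toTemperedDistribution_toLp_eq]

theorem apply_eq_inner_toLp {W : orthNull L →L[ℂ] (ℝ →₂[volume] ℂ)} (hL : PreservesReal L)
    (hW : ∀ η, W ⟨transpose L η, transpose_mem_orthNull η⟩ = η.toLp 2 volume)
    {f : 𝓢'(ℝ, ℂ)} (hf : IsReal f) {v : ℝ →₂[volume] ℂ} (hv : (v : 𝓢'(ℝ, ℂ)) = L f)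
    (ψ : orthNull L) : f ψ = inner ℂ v (W ψ) := by
  have hleft := (map_continuous f).comp (continuous_subtype_val (p := (· ∈ orthNull L)))
  have hright := (innerSL ℂ v).continuous.comp W.continuous
  refine (denseRange_transpose hL).induction_on
    (p := fun ψ : orthNull L => f ψ = inner ℂ v (W ψ)) ψ (isClosed_eq hleft hright) fun η => ?_
  rw [hW, inner_toLp_eq_apply (by rw [hv]; exact hL f hf), hv, apply_transpose]

theorem exists_l2_correlate (hL : PreservesReal L) (hLhat : IsFrequencyResponse L Lhat)
    (hρ : IsGreenAdjointSelf L ρ) {ψ : 𝓢(ℝ, ℂ)} (hψ : ψ ∈ orthNull L) :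
    ∃ w : ℝ →₂[volume] ℂ, (w : 𝓢'(ℝ, ℂ)) = L (correlate ρ ψ) ∧
      ∀ f, IsReal f → ∀ v : ℝ →₂[volume] ℂ, (v : 𝓢'(ℝ, ℂ)) = L f → f ψ = inner ℂ v w := by
  obtain ⟨W, hW⟩ := exists_orthNull_toLp hL hLhat hρ
  exact ⟨W ⟨ψ, hψ⟩, coe_toLp_eq_map_correlate hL hLhat hρ hW ⟨ψ, hψ⟩,
    fun f hf v hv => apply_eq_inner_toLp hL hW hf hv ⟨ψ, hψ⟩⟩

theorem exists_isReal_map_eq (hL : PreservesReal L) (hLhat : IsFrequencyResponse L Lhat)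
    (hρ : IsGreenAdjointSelf L ρ) {v : ℝ →₂[volume] ℂ} (hv : IsReal (v : 𝓢'(ℝ, ℂ))) :
    ∃ f, IsReal f ∧ L f = (v : 𝓢'(ℝ, ℂ)) := by
  obtain ⟨S, hS⟩ := exists_range_transpose_toLp hL hLhat hρ
  have : PolynormableSpace ℂ 𝓢(ℝ, ℂ) := (schwartz_withSeminorms ℂ ℝ ℂ).toPolynormableSpace
  obtain ⟨u, hu⟩ := StrongDual.exists_extension (LinearMap.range (transpose L)) (innerSL ℂ v ∘L S)
  let f : 𝓢'(ℝ, ℂ) := ContinuousLinearMap.toPointwiseConvergenceCLM ℂ (RingHom.id ℂ) 𝓢(ℝ, ℂ) ℂ u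
  have hf : L f = (v : 𝓢'(ℝ, ℂ)) := by
    ext η
    rw [← apply_transpose, ← inner_toLp_eq_apply hv, ← hS]
    exact hu ⟨transpose L η, η, rfl⟩
  exact ⟨reDist f, isReal_reDist f, by rw [map_reDist hL, hf, hv.reDist_eq]⟩

end Surjectivity

/-! ### Tikhonov functionals -/

section Functional

variable {X Y V : Type*} [NormedAddCommGroup V] {F : Y → ℝ≥0∞} {lam : ℝ} {H : X → Y} {A : X → V}

/-- The Tikhonov functional with data term `F`, measurement map `H`, and the squared norm of `A`,
weighted by `lam`, as regularization. -/
def tikhonov (F : Y → ℝ≥0∞) (lam : ℝ) (H : X → Y) (A : X → V) (x : X) : ℝ≥0∞ :=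
  F (H x) + ENNReal.ofReal lam * ‖A x‖ₑ ^ 2

theorem tikhonov_ne_top_iff {x : X} : tikhonov F lam H A x ≠ ⊤ ↔ F (H x) ≠ ⊤ := by
  have hreg : ENNReal.ofReal lam * ‖A x‖ₑ ^ 2 ≠ ⊤ :=
    ENNReal.mul_ne_top ENNReal.ofReal_ne_top (ENNReal.pow_ne_top enorm_ne_top)
  simp only [tikhonov, ENNReal.add_ne_top, and_iff_left hreg]

theorem tikhonov_le_tikhonov_iff (hlam : 0 < lam) {x y : X} (hH : H x = H y)
    (hx : F (H x) ≠ ⊤) : tikhonov F lam H A x ≤ tikhonov F lam H A y ↔ ‖A x‖ ≤ ‖A y‖ := by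
  rw [tikhonov, tikhonov, ← hH, ENNReal.add_le_add_iff_left hx,
    ENNReal.mul_le_mul_iff_right (by simpa using hlam) ENNReal.ofReal_ne_top,
    ENNReal.pow_le_pow_left_iff two_ne_zero, enorm_le_iff_norm_le]

theorem lowerSemicontinuous_tikhonov [TopologicalSpace X] [TopologicalSpace Y]
    (hF : LowerSemicontinuous F) (hH : Continuous H) (hA : Continuous A) :
    LowerSemicontinuous (tikhonov F lam H A) := by
  refine (hF.comp hH).add (Continuous.lowerSemicontinuous ?_)
  exact (ENNReal.continuous_const_mul ENNReal.ofReal_ne_top).comp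
    ((ENNReal.continuous_pow 2).comp hA.enorm)

end Functional

section Existence

variable {X V K : Type*} {M : ℕ} {F : (Fin M → ℝ) → ℝ≥0∞} {lam : ℝ}

theorem IsCoercive.isBounded_sublevel (hF : IsCoercive F) {c : ℝ≥0∞} (hc : c ≠ ⊤) :
    Bornology.IsBounded {u | F u ≤ c} := by
  have hlt : ∀ᶠ u in cocompact (Fin M → ℝ), c < F u := hF.eventually (lt_mem_nhds hc.lt_top)
  obtain ⟨t, ht, hsub⟩ := mem_cocompact.1 hlt
  refine ht.isBounded.subset fun u (hu : F u ≤ c) => ?_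
  by_contra hut
  exact (hsub hut).not_ge hu

theorem isBounded_setOf_mul_enorm_sq_le [NormedAddCommGroup V] (hlam : 0 < lam) {c : ℝ≥0∞}
    (hc : c ≠ ⊤) : Bornology.IsBounded {v : V | ENNReal.ofReal lam * ‖v‖ₑ ^ 2 ≤ c} := by
  refine (Metric.isBounded_closedBall (x := 0) (r := √(c.toReal / lam))).subset fun v hv => ?_
  have hreal := ENNReal.toReal_mono hc hv
  rw [ENNReal.toReal_mul, ENNReal.toReal_pow, toReal_enorm, ENNReal.toReal_ofReal hlam.le,
    ← le_div_iff₀' hlam] at hreal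
  rw [mem_closedBall_zero_iff]
  exact Real.le_sqrt_of_sq_le hreal

variable [NormedAddCommGroup V]

theorem isBounded_tikhonov_sublevel [NormedAddCommGroup X] [NormedSpace ℝ X]
    [FiniteDimensional ℝ X] [NormedSpace ℝ V] {H : X →ₗ[ℝ] (Fin M → ℝ)} {A : X →ₗ[ℝ] V}
    (hHA : Function.Injective (H.prod A)) (hF : IsCoercive F) (hlam : 0 < lam) {c : ℝ≥0∞}
    (hc : c ≠ ⊤) : Bornology.IsBounded {x | tikhonov F lam H A x ≤ c} := by
  obtain ⟨_, -, hanti⟩ := LinearMap.exists_antilipschitzWith (H.prod A) (LinearMap.ker_eq_bot.2 hHA)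
  refine (hanti.isBounded_preimage ((hF.isBounded_sublevel hc).prod
    (isBounded_setOf_mul_enorm_sq_le hlam hc))).subset
    fun x (hx : tikhonov F lam H A x ≤ c) => ?_
  exact ⟨le_self_add.trans hx, (le_add_self (a := ENNReal.ofReal lam * ‖A x‖ₑ ^ 2)).trans hx⟩

theorem exists_tikhonov_le_of_finiteDimensional [NormedAddCommGroup X] [NormedSpace ℝ X]
    [FiniteDimensional ℝ X] [NormedSpace ℝ V] {H : X →ₗ[ℝ] (Fin M → ℝ)} {A : X →ₗ[ℝ] V}
    (hHA : Function.Injective (H.prod A)) (hlsc : LowerSemicontinuous F) (hcoer : IsCoercive F)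
    (hlam : 0 < lam) {x₀ : X} (hx₀ : F (H x₀) ≠ ⊤) :
    ∃ x, ∀ y, tikhonov F lam H A x ≤ tikhonov F lam H A y := by
  have : ProperSpace X := FiniteDimensional.proper ℝ X
  have hJ : LowerSemicontinuous (tikhonov F lam H A) := lowerSemicontinuous_tikhonov hlsc
    H.continuous_of_finiteDimensional A.continuous_of_finiteDimensional
  have hcompact : IsCompact {x | tikhonov F lam H A x ≤ tikhonov F lam H A x₀} :=
    Metric.isCompact_of_isClosed_isBounded (hJ.isClosed_preimage _)
      (isBounded_tikhonov_sublevel hHA hcoer hlam (tikhonov_ne_top_iff.2 hx₀))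
  obtain ⟨x, hx, hmin⟩ := LowerSemicontinuousOn.exists_isMinOn
    ⟨x₀, le_refl (tikhonov F lam H A x₀)⟩ hcompact
    (hJ.lowerSemicontinuousOn _)
  refine ⟨x, fun y => ?_⟩
  rcases le_total (tikhonov F lam H A y) (tikhonov F lam H A x₀) with hy | hy
  · exact hmin hy
  · exact le_trans hx hy

theorem finiteDimensional_orthogonal_ker {Y : Type*} [InnerProductSpace ℝ V] [AddCommGroup Y]
    [Module ℝ Y] [FiniteDimensional ℝ Y] (G : V →ₗ[ℝ] Y) :
    FiniteDimensional ℝ (LinearMap.ker G)ᗮ := by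
  refine FiniteDimensional.of_injective (G ∘ₗ (LinearMap.ker G)ᗮ.subtype)
    (LinearMap.ker_eq_bot.1 (LinearMap.ker_eq_bot'.2 fun w hw => ?_))
  have hmem : (w : V) ∈ LinearMap.ker G ⊓ (LinearMap.ker G)ᗮ := ⟨hw, w.2⟩
  rw [Submodule.inf_orthogonal_eq_bot, Submodule.mem_bot] at hmem
  exact Subtype.ext hmem

-- Projecting the first component onto the orthogonal complement of the kernel of `G (·, 0)` keeps
-- the measurements and decreases the regularization, which reduces the problem to finite dimension.
theorem exists_tikhonov_le_of_completeSpace [InnerProductSpace ℝ V] [CompleteSpace V]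
    [NormedAddCommGroup K] [NormedSpace ℝ K] [FiniteDimensional ℝ K]
    {G : V × K →L[ℝ] (Fin M → ℝ)} (hG : ∀ k, G (0, k) = 0 → k = 0)
    (hlsc : LowerSemicontinuous F) (hcoer : IsCoercive F) (hlam : 0 < lam)
    {x₀ : V × K} (hx₀ : F (G x₀) ≠ ⊤) :
    ∃ x, ∀ y, tikhonov F lam G Prod.fst x ≤ tikhonov F lam G Prod.fst y := by
  let G₁ : V →L[ℝ] (Fin M → ℝ) := G ∘L ContinuousLinearMap.inl ℝ V K
  let U : Submodule ℝ V := LinearMap.ker (G₁ : V →ₗ[ℝ] (Fin M → ℝ))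
  have : CompleteSpace U := G₁.isClosed_ker.completeSpace_coe
  have : FiniteDimensional ℝ Uᗮ := finiteDimensional_orthogonal_ker _
  let H : Uᗮ × K →ₗ[ℝ] (Fin M → ℝ) := G ∘ₗ Uᗮ.subtype.prodMap LinearMap.id
  let P (x : V × K) : Uᗮ × K := (Uᗮ.orthogonalProjectionOnto x.1, x.2)
  have hP (x : V × K) : H (P x) = G x := by
    have hsub : x.1 - Uᗮ.orthogonalProjectionOnto x.1 ∈ U := by
      have hmem := Uᗮ.sub_starProjection_mem_orthogonal x.1
      rwa [Submodule.orthogonal_orthogonal] at hmem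
    have hker : G (x.1 - Uᗮ.orthogonalProjectionOnto x.1, 0) = 0 := hsub
    change G (Uᗮ.orthogonalProjectionOnto x.1, x.2) = G x
    rw [eq_comm, ← sub_eq_zero, ← map_sub, ← hker]
    congr 1
    ext <;> simp
  have hinj : Function.Injective (H.prod (LinearMap.fst ℝ Uᗮ K)) := by
    refine (injective_iff_map_eq_zero _).2 ?_
    rintro ⟨w, k⟩ hwk
    obtain ⟨hHwk, rfl : w = 0⟩ := Prod.mk.inj hwk
    rw [hG k hHwk, Prod.mk_zero_zero]
  obtain ⟨x, hx⟩ := exists_tikhonov_le_of_finiteDimensional hinj hlsc hcoer hlam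
    (x₀ := P x₀) (by rwa [hP])
  refine ⟨(x.1, x.2), fun y => (hx (P y)).trans ?_⟩
  rw [tikhonov, tikhonov, hP]
  gcongr
  exact enorm_le_iff_norm_le.2 (Uᗮ.norm_orthogonalProjectionOnto_apply_le y.1)

end Existence

section Uniqueness

variable {X V : Type*} [AddCommGroup X] [Module ℝ X] [NormedAddCommGroup V] [InnerProductSpace ℝ V]
  {M : ℕ} {F : (Fin M → ℝ) → ℝ≥0∞} {lam s t : ℝ} {H : X →ₗ[ℝ] (Fin M → ℝ)} {A : X →ₗ[ℝ] V}

theorem ofReal_mul_add_ofReal_mul (hs : 0 ≤ s) (ht : 0 ≤ t) (hst : s + t = 1) (c : ℝ≥0∞) :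
    ENNReal.ofReal s * c + ENNReal.ofReal t * c = c := by
  rw [← add_mul, ← ENNReal.ofReal_add hs ht, hst, ENNReal.ofReal_one, one_mul]

theorem IsStrictlyConvex.isConvex (hF : IsStrictlyConvex F) : IsConvex F := by
  intro u v s t hs ht hst
  rcases eq_or_ne u v with rfl | huv
  · rw [← add_smul, hst, one_smul, ofReal_mul_add_ofReal_mul hs.le ht.le hst]
  by_cases hu : F u = ⊤
  · simp [hu, ENNReal.mul_top, hs]
  by_cases hv : F v = ⊤
  · simp [hv, ENNReal.mul_top, ht]
  exact (hF u v huv hu hv s t hs ht hst).le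

theorem strictConvexOn_norm_sq : StrictConvexOn ℝ Set.univ fun v : V => ‖v‖ ^ 2 := by
  have hstrong : StrongConvexOn Set.univ 2 fun v : V => ‖v‖ ^ 2 :=
    strongConvexOn_iff_convex.2 (by simpa using convexOn_const 0 convex_univ)
  exact hstrong.strictConvexOn two_pos

theorem enorm_sq_smul_add_smul_lt {v w : V} (hvw : v ≠ w) (hs : 0 < s) (ht : 0 < t)
    (hst : s + t = 1) :
    ‖s • v + t • w‖ₑ ^ 2 < ENNReal.ofReal s * ‖v‖ₑ ^ 2 + ENNReal.ofReal t * ‖w‖ₑ ^ 2 := by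
  have hlt := strictConvexOn_norm_sq.2 (Set.mem_univ v) (Set.mem_univ w) hvw hs ht hst
  have henorm (x : V) : ‖x‖ₑ ^ 2 = ENNReal.ofReal (‖x‖ ^ 2) := by
    rw [ENNReal.ofReal_pow (norm_nonneg x), ofReal_norm]
  rw [henorm, henorm, henorm, ← ENNReal.ofReal_mul hs.le, ← ENNReal.ofReal_mul ht.le,
    ← ENNReal.ofReal_add (by positivity) (by positivity)]
  exact (ENNReal.ofReal_lt_ofReal_iff_of_nonneg (by positivity)).2 hlt

theorem enorm_sq_smul_add_smul_le (v w : V) (hs : 0 < s) (ht : 0 < t) (hst : s + t = 1) :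
    ‖s • v + t • w‖ₑ ^ 2 ≤ ENNReal.ofReal s * ‖v‖ₑ ^ 2 + ENNReal.ofReal t * ‖w‖ₑ ^ 2 := by
  rcases eq_or_ne v w with rfl | hvw
  · rw [← add_smul, hst, one_smul, ofReal_mul_add_ofReal_mul hs.le ht.le hst]
  · exact (enorm_sq_smul_add_smul_lt hvw hs ht hst).le

theorem tikhonov_smul_add_smul_lt (hF : IsStrictlyConvex F) (hlam : 0 < lam)
    (hHA : Function.Injective (H.prod A)) {x y : X} (hxy : x ≠ y) (hx : F (H x) ≠ ⊤)
    (hy : F (H y) ≠ ⊤) (hs : 0 < s) (ht : 0 < t) (hst : s + t = 1) :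
    tikhonov F lam H A (s • x + t • y) <
      ENNReal.ofReal s * tikhonov F lam H A x + ENNReal.ofReal t * tikhonov F lam H A y := by
  have hrearrange : ENNReal.ofReal s * tikhonov F lam H A x +
      ENNReal.ofReal t * tikhonov F lam H A y =
      (ENNReal.ofReal s * F (H x) + ENNReal.ofReal t * F (H y)) +
        ENNReal.ofReal lam * (ENNReal.ofReal s * ‖A x‖ₑ ^ 2 + ENNReal.ofReal t * ‖A y‖ₑ ^ 2) := by
    simp only [tikhonov]
    ring
  have hdata := hF.isConvex (H x) (H y) s t hs ht hst
  have hdata_top := ENNReal.add_ne_top.2 ⟨ENNReal.mul_ne_top (ENNReal.ofReal_ne_top (r := s)) hx,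
    ENNReal.mul_ne_top (ENNReal.ofReal_ne_top (r := t)) hy⟩
  rw [hrearrange, tikhonov, map_add, map_smul, map_smul, map_add, map_smul, map_smul]
  by_cases hA : A x = A y
  · have hH : H x ≠ H y := fun hH => hxy (hHA (Prod.ext hH hA))
    refine ENNReal.add_lt_add_of_lt_of_le
      (ENNReal.mul_ne_top ENNReal.ofReal_ne_top (ENNReal.pow_ne_top enorm_ne_top))
      (hF _ _ hH hx hy s t hs ht hst) ?_
    gcongr
    exact enorm_sq_smul_add_smul_le _ _ hs ht hst
  · refine ENNReal.add_lt_add_of_le_of_lt (ne_top_of_le_ne_top hdata_top hdata) hdata ?_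
    exact (ENNReal.mul_lt_mul_iff_right (by simpa using hlam) ENNReal.ofReal_ne_top).2
      (enorm_sq_smul_add_smul_lt hA hs ht hst)

theorem eq_of_forall_tikhonov_le (hF : IsStrictlyConvex F) (hlam : 0 < lam)
    (hHA : Function.Injective (H.prod A)) {x y : X} (hx : F (H x) ≠ ⊤) (hy : F (H y) ≠ ⊤)
    (hxmin : ∀ w, tikhonov F lam H A x ≤ tikhonov F lam H A w)
    (hymin : ∀ w, tikhonov F lam H A y ≤ tikhonov F lam H A w) : x = y := by
  by_contra hxy
  have hhalf : (0 : ℝ) < 1 / 2 := one_half_pos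
  have hlt := tikhonov_smul_add_smul_lt hF hlam hHA hxy hx hy hhalf hhalf (add_halves 1)
  rw [← (hxmin y).antisymm (hymin x),
    ofReal_mul_add_ofReal_mul hhalf.le hhalf.le (add_halves 1)] at hlt
  exact hlt.not_ge (hxmin _)

end Uniqueness

section Representation

theorem exists_eq_sum_mul_of_ker_le {k X ι : Type*} [Field k] [AddCommGroup X] [Module k X]
    [Fintype ι] {H : X →ₗ[k] (ι → k)} {u : X →ₗ[k] k} (hu : LinearMap.ker H ≤ LinearMap.ker u) :
    ∃ a : ι → k, ∀ x, u x = ∑ i, a i * H x i := by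
  have hspan : u ∈ Submodule.span k (Set.range fun i => LinearMap.proj i ∘ₗ H) :=
    mem_span_of_iInf_ker_le_ker fun x hx =>
      hu (LinearMap.mem_ker.2 (funext fun i => (Submodule.mem_iInf _).1 hx i))
  obtain ⟨a, ha⟩ := (Submodule.mem_span_range_iff_exists_fun k).1 hspan
  refine ⟨a, fun x => ?_⟩
  rw [← ha]
  simp

variable {X V : Type*} [AddCommGroup X] [Module ℝ X] [NormedAddCommGroup V] [InnerProductSpace ℝ V]
  {M : ℕ} {F : (Fin M → ℝ) → ℝ≥0∞} {lam : ℝ} {H : X →ₗ[ℝ] (Fin M → ℝ)} {A : X →ₗ[ℝ] V}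

theorem inner_eq_zero_of_forall_tikhonov_le (hlam : 0 < lam) {x : X} (hx : F (H x) ≠ ⊤)
    (hxmin : ∀ w, tikhonov F lam H A x ≤ tikhonov F lam H A w) {y : X} (hy : H y = 0) :
    inner ℝ (A x) (A y) = 0 := by
  have hmin (w : (LinearMap.ker H).map A) : ‖A x - 0‖ ≤ ‖A x - w‖ := by
    obtain ⟨_, z, hz, rfl⟩ := w
    have hH : H x = H (x - z) := by rw [map_sub, LinearMap.mem_ker.1 hz, sub_zero]
    simpa using (tikhonov_le_tikhonov_iff hlam hH hx).1 (hxmin (x - z))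
  have hiInf : ‖A x - 0‖ = ⨅ w : (LinearMap.ker H).map A, ‖A x - w‖ :=
    le_antisymm (le_ciInf hmin)
      (ciInf_le ⟨0, Set.forall_mem_range.2 fun _ => norm_nonneg _⟩ (0 : (LinearMap.ker H).map A))
  simpa using (Submodule.norm_eq_iInf_iff_real_inner_eq_zero _ (Submodule.zero_mem _)).1 hiInf
    (A y) (Submodule.mem_map_of_mem hy)

theorem exists_inner_eq_sum_of_forall_tikhonov_le (hlam : 0 < lam) {x : X} (hx : F (H x) ≠ ⊤)
    (hxmin : ∀ w, tikhonov F lam H A x ≤ tikhonov F lam H A w) :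
    ∃ a : Fin M → ℝ, ∀ y, inner ℝ (A x) (A y) = ∑ m, a m * H y m :=
  exists_eq_sum_mul_of_ker_le (u := (innerSL ℝ (A x)).toLinearMap ∘ₗ A) fun _ hy =>
    inner_eq_zero_of_forall_tikhonov_le hlam hx hxmin hy

end Representation

/-! ### The search space as a Hilbert space -/

section RealL2

theorem real_smul_eq_coe_smul (c : ℝ) (f : 𝓢'(ℝ, ℂ)) : c • f = (c : ℂ) • f := by
  ext ψ
  simp

/-- The real square-integrable functions, as a real Hilbert space. -/
def realL2 : Submodule ℝ (ℝ →₂[volume] ℂ) where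
  carrier := {w | IsReal (w : 𝓢'(ℝ, ℂ))}
  zero_mem' := fun ψ _ => by
    rw [← Lp.toTemperedDistributionCLM_apply, map_zero]
    rfl
  add_mem' := fun {v w} hv hw ψ hψ => by
    rw [coe_l2_add]
    change ((v : 𝓢'(ℝ, ℂ)) ψ + (w : 𝓢'(ℝ, ℂ)) ψ).im = 0
    rw [Complex.add_im, hv ψ hψ, hw ψ hψ, add_zero]
  smul_mem' := fun c v hv ψ hψ => by
    rw [RCLike.real_smul_eq_coe_smul (K := ℂ) c v, coe_l2_smul]
    change ((c : ℂ) * (v : 𝓢'(ℝ, ℂ)) ψ).im = 0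
    rw [Complex.im_ofReal_mul, hv ψ hψ, mul_zero]

theorem isClosed_realL2 : IsClosed (realL2 : Set (ℝ →₂[volume] ℂ)) := by
  have hiInter : (realL2 : Set (ℝ →₂[volume] ℂ)) =
      ⋂ (ψ : 𝓢(ℝ, ℂ)) (_ : IsRealTest ψ),
        {w : ℝ →₂[volume] ℂ | ((w : 𝓢'(ℝ, ℂ)) ψ).im = 0} := by
    ext w
    simp only [Set.mem_iInter]
    rfl
  rw [hiInter]
  exact isClosed_iInter fun ψ => isClosed_iInter fun _ =>
    isClosed_eq (Complex.continuous_im.comp (continuous_coe_l2_apply ψ)) continuous_const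

instance : CompleteSpace realL2 := isClosed_realL2.completeSpace_coe

theorem real_inner_l2_eq_re (v w : ℝ →₂[volume] ℂ) : inner ℝ v w = (inner ℂ v w).re := by
  rw [L2.inner_def, L2.inner_def]
  exact integral_re (L2.integrable_inner (𝕜 := ℂ) v w)

end RealL2

section SearchSpace

variable {L : 𝓢'(ℝ, ℂ) →L[ℂ] 𝓢'(ℝ, ℂ)} {Lhat : ℝ → ℂ} {ρ : 𝓢'(ℝ, ℂ)} {N₀ M : ℕ}

theorem exists_realL2_coe_eq (hL : PreservesReal L) (f : X2 L) :
    ∃ w : realL2, ((w : ℝ →₂[volume] ℂ) : 𝓢'(ℝ, ℂ)) = L f := by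
  obtain ⟨w, hw⟩ := (l2Norm_lt_top_iff _).1 f.2.2
  exact ⟨⟨w, show IsReal _ by rw [hw]; exact hL _ f.2.1⟩, hw⟩

/-- The square-integrable function that represents `L f`, for `f` in the search space. -/
def l2Rep (hL : PreservesReal L) (f : X2 L) : realL2 := (exists_realL2_coe_eq hL f).choose

theorem coe_l2Rep (hL : PreservesReal L) (f : X2 L) :
    ((l2Rep hL f : ℝ →₂[volume] ℂ) : 𝓢'(ℝ, ℂ)) = L f :=
  (exists_realL2_coe_eq hL f).choose_spec

/-- The operator `L` from the search space to the real square-integrable functions. -/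
def l2Image (hL : PreservesReal L) : X2 L →ₗ[ℝ] realL2 where
  toFun := l2Rep hL
  map_add' f g := Subtype.ext <| l2_ext <| by
    rw [Submodule.coe_add, coe_l2_add, coe_l2Rep, coe_l2Rep, coe_l2Rep, ← map_add]
    rfl
  map_smul' c f := Subtype.ext <| l2_ext <| by
    rw [Submodule.coe_smul, RCLike.real_smul_eq_coe_smul (K := ℂ) (RingHom.id ℝ c), coe_l2_smul,
      coe_l2Rep, coe_l2Rep, ← map_smul]
    exact congrArg L (real_smul_eq_coe_smul c f)

theorem coe_l2Image (hL : PreservesReal L) (f : X2 L) :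
    ((l2Image hL f : ℝ →₂[volume] ℂ) : 𝓢'(ℝ, ℂ)) = L f :=
  coe_l2Rep hL f

theorem l2Norm_apply (hL : PreservesReal L) (f : X2 L) : l2Norm (L f) = ‖l2Image hL f‖ₑ := by
  rw [← coe_l2Image hL, l2Norm_coe]
  rfl

theorem l2Image_eq_zero_iff (hL : PreservesReal L) (f : X2 L) :
    l2Image hL f = 0 ↔ f ∈ nullSpace L := by
  have hzero : ((0 : ℝ →₂[volume] ℂ) : 𝓢'(ℝ, ℂ)) = 0 :=
    map_zero (Lp.toTemperedDistributionCLM ℂ volume 2)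
  refine ⟨fun hf => ?_, fun hf => Subtype.ext (l2_ext ?_)⟩
  · change L f = 0
    rw [← coe_l2Image hL, hf, Submodule.coe_zero, hzero]
  · rw [coe_l2Image, show L f = 0 from hf, Submodule.coe_zero, hzero]

theorem exists_l2Image_eq (hL : PreservesReal L) (hLhat : IsFrequencyResponse L Lhat)
    (hρ : IsGreenAdjointSelf L ρ) (v : realL2) : ∃ f, l2Image hL f = v := by
  obtain ⟨f, hf, hLf⟩ := exists_isReal_map_eq hL hLhat hρ v.2
  exact ⟨⟨f, hf, by rw [hLf]; exact (l2Norm_lt_top_iff _).2 ⟨v, rfl⟩⟩,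
    Subtype.ext (l2_ext ((coe_l2Image hL _).trans hLf))⟩

theorem correlate_mem_X2 (hL : PreservesReal L) (hLhat : IsFrequencyResponse L Lhat)
    (hρ : IsGreenAdjointSelf L ρ) {ψ : 𝓢(ℝ, ℂ)} (hψ : IsRealTest ψ) (hψL : ψ ∈ orthNull L) :
    correlate ρ ψ ∈ X2 L := by
  obtain ⟨w, hw, -⟩ := exists_l2_correlate hL hLhat hρ hψL
  exact ⟨isReal_correlate hρ.1 hψ, (l2Norm_lt_top_iff _).2 ⟨w, hw⟩⟩

theorem apply_eq_inner_correlate (hL : PreservesReal L) (hLhat : IsFrequencyResponse L Lhat)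
    (hρ : IsGreenAdjointSelf L ρ) {ψ : 𝓢(ℝ, ℂ)} (hψ : IsRealTest ψ) (hψL : ψ ∈ orthNull L)
    (hmem : correlate ρ ψ ∈ X2 L) (f : X2 L) :
    (f : 𝓢'(ℝ, ℂ)) ψ = (inner ℝ (l2Image hL f) (l2Image hL ⟨correlate ρ ψ, hmem⟩) : ℝ) := by
  obtain ⟨w, hw, hinner⟩ := exists_l2_correlate hL hLhat hρ hψL
  have himage : (l2Image hL ⟨correlate ρ ψ, hmem⟩ : ℝ →₂[volume] ℂ) = w :=
    l2_ext ((coe_l2Image hL _).trans hw.symm)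
  rw [Submodule.coe_inner, himage, real_inner_l2_eq_re, ← hinner f f.2.1 _ (coe_l2Image hL f),
    f.2.1.coe_re_apply hψ]

variable (L) in
/-- The pairings of an element of the search space with the Schwartz functions `κ`. The real parts
lose nothing, since only real `κ` are of interest. -/
def pairings (κ : Fin N₀ → 𝓢(ℝ, ℂ)) : X2 L →ₗ[ℝ] (Fin N₀ → ℝ) where
  toFun f n := ((f : 𝓢'(ℝ, ℂ)) (κ n)).re
  map_add' f g := by ext n; exact Complex.add_re _ _
  map_smul' c f := by
    ext n
    change ((c • (f : 𝓢'(ℝ, ℂ))) (κ n)).re = c * _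
    rw [real_smul_eq_coe_smul]
    exact Complex.re_ofReal_mul _ _

@[simp]
theorem pairings_apply (κ : Fin N₀ → 𝓢(ℝ, ℂ)) (f : X2 L) (n : Fin N₀) :
    pairings L κ f n = ((f : 𝓢'(ℝ, ℂ)) (κ n)).re := rfl

/-- The real Schwartz functions `κ` form a system biorthonormal to the basis `p` of the null
space. -/
structure IsBiorthonormal (p : Module.Basis (Fin N₀) ℝ (nullSpace L)) (κ : Fin N₀ → 𝓢(ℝ, ℂ)) :
    Prop where
  real : ∀ n, IsRealTest (κ n)
  apply_eq : ∀ i j, ((p i : X2 L) : 𝓢'(ℝ, ℂ)) (κ j) = if i = j then 1 else 0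

variable {p : Module.Basis (Fin N₀) ℝ (nullSpace L)} {κ : Fin N₀ → 𝓢(ℝ, ℂ)}

theorem IsBiorthonormal.pairings_sum (hκ : IsBiorthonormal p κ) (c : Fin N₀ → ℝ) :
    pairings L κ (∑ n, c n • (p n : X2 L)) = c := by
  rw [map_sum]
  ext j
  simp [hκ.apply_eq, apply_ite Complex.re]

theorem IsBiorthonormal.injective_l2Image_prod_pairings (hκ : IsBiorthonormal p κ)
    (hL : PreservesReal L) : Function.Injective ((l2Image hL).prod (pairings L κ)) := by
  refine (injective_iff_map_eq_zero _).2 fun f hf => ?_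
  obtain ⟨himage, hpairings⟩ := Prod.mk.inj hf
  set q : nullSpace L := ⟨f, (l2Image_eq_zero_iff hL f).1 himage⟩
  have hsum : ∑ n, p.repr q n • (p n : X2 L) = f := by
    simpa only [Submodule.coe_sum, Submodule.coe_smul] using congrArg Subtype.val (p.sum_repr q)
  have hrepr : (p.repr q : Fin N₀ → ℝ) = 0 := by
    rw [← hκ.pairings_sum (p.repr q), hsum]
    exact hpairings
  rw [← hsum]
  simp [hrepr]

theorem IsBiorthonormal.surjective_l2Image_prod_pairings (hκ : IsBiorthonormal p κ)
    (hL : PreservesReal L) (hLhat : IsFrequencyResponse L Lhat) (hρ : IsGreenAdjointSelf L ρ) :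
    Function.Surjective ((l2Image hL).prod (pairings L κ)) := by
  rintro ⟨v, c⟩
  obtain ⟨f, hf⟩ := exists_l2Image_eq hL hLhat hρ v
  have hnull (n : Fin N₀) : l2Image hL (p n) = 0 := (l2Image_eq_zero_iff hL _).2 (p n).2
  refine ⟨f + ∑ n, (c - pairings L κ f) n • (p n : X2 L), Prod.ext ?_ ?_⟩
  · change l2Image hL _ = v
    simp [hf, hnull]
  · change pairings L κ _ = c
    rw [map_add, hκ.pairings_sum, add_sub_cancel]

theorem IsBiorthonormal.bijective_l2Image_prod_pairings (hκ : IsBiorthonormal p κ)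
    (hL : PreservesReal L) (hLhat : IsFrequencyResponse L Lhat) (hρ : IsGreenAdjointSelf L ρ) :
    Function.Bijective ((l2Image hL).prod (pairings L κ)) :=
  ⟨hκ.injective_l2Image_prod_pairings hL, hκ.surjective_l2Image_prod_pairings hL hLhat hρ⟩

theorem IsBiorthonormal.sub_sum_smul_mem_orthNull (hκ : IsBiorthonormal p κ) (ψ : 𝓢(ℝ, ℂ)) :
    ψ - ∑ n, ((p n : X2 L) : 𝓢'(ℝ, ℂ)) ψ • κ n ∈ orthNull L := by
  have hbasis (i : Fin N₀) : ((p i : X2 L) : 𝓢'(ℝ, ℂ))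
      (ψ - ∑ n, ((p n : X2 L) : 𝓢'(ℝ, ℂ)) ψ • κ n) = 0 := by
    rw [map_sub, map_sum]
    simp [hκ.apply_eq]
  intro q
  rw [← p.sum_repr q]
  simp only [Submodule.coe_sum, Submodule.coe_smul]
  simp [hbasis]

theorem IsBiorthonormal.eq_sum_of_forall_orthNull (hκ : IsBiorthonormal p κ) {u : 𝓢'(ℝ, ℂ)}
    (hu : IsReal u) (hzero : ∀ ψ : 𝓢(ℝ, ℂ), IsRealTest ψ → ψ ∈ orthNull L → u ψ = 0) :
    u = ∑ n, (u (κ n)).re • ((p n : X2 L) : 𝓢'(ℝ, ℂ)) := by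
  refine ext_of_isRealTest fun ψ hψ => ?_
  have hreal : IsRealTest (ψ - ∑ n, ((p n : X2 L) : 𝓢'(ℝ, ℂ)) ψ • κ n) := by
    intro x
    simp [hψ x, hκ.real _ x, (p _ : X2 L).2.1 ψ hψ]
  have hsub := hzero _ hreal (hκ.sub_sum_smul_mem_orthNull ψ)
  rw [map_sub, map_sum, sub_eq_zero] at hsub
  rw [hsub]
  simp_rw [map_smul, real_smul_eq_coe_smul, hu.coe_re_apply (hκ.real _)]
  simp [mul_comm]

theorem nativeNorm_le (hL : PreservesReal L) (κ : Fin N₀ → 𝓢(ℝ, ℂ)) (f : X2 L) :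
    nativeNorm L κ f ≤ √(1 + N₀) * ‖(l2Image hL f, pairings L κ f)‖ := by
  rw [nativeNorm, l2Norm_apply hL, toReal_enorm]
  set x := (l2Image hL f, pairings L κ f)
  have hfst : ‖l2Image hL f‖ ^ 2 ≤ ‖x‖ ^ 2 := by
    gcongr
    exact norm_fst_le x
  have hsnd (n : Fin N₀) : ((f : 𝓢'(ℝ, ℂ)) (κ n)).re ^ 2 ≤ ‖x‖ ^ 2 := by
    have hn : ‖pairings L κ f n‖ ≤ ‖x‖ := (norm_le_pi_norm _ n).trans (norm_snd_le x)
    rw [← sq_abs]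
    exact pow_le_pow_left₀ (abs_nonneg _) hn 2
  rw [← Real.sqrt_sq (norm_nonneg x), ← Real.sqrt_mul (by positivity)]
  refine Real.sqrt_le_sqrt ?_
  calc _ ≤ ‖x‖ ^ 2 + ∑ _n : Fin N₀, ‖x‖ ^ 2 :=
      add_le_add hfst (Finset.sum_le_sum fun n _ => hsnd n)
    _ = (1 + N₀) * ‖x‖ ^ 2 := by simp; ring

theorem exists_continuousLinearMap_factorization (hL : PreservesReal L)
    (hbij : Function.Bijective ((l2Image hL).prod (pairings L κ)))
    {H : X2 L →ₗ[ℝ] (Fin M → ℝ)} {C : ℝ} (hC : ∀ f, ‖H f‖ ≤ C * nativeNorm L κ f) :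
    ∃ G : realL2 × (Fin N₀ → ℝ) →L[ℝ] (Fin M → ℝ),
      ∀ f, H f = G (l2Image hL f, pairings L κ f) := by
  let e := LinearEquiv.ofBijective _ hbij
  have he (f : X2 L) : (H ∘ₗ e.symm.toLinearMap) (l2Image hL f, pairings L κ f) = H f :=
    congrArg H (e.symm_apply_apply f)
  refine ⟨(H ∘ₗ e.symm.toLinearMap).mkContinuous (|C| * √(1 + N₀)) fun x => ?_,
    fun f => (he f).symm⟩
  obtain ⟨f, rfl⟩ := hbij.surjective x
  calc ‖(H ∘ₗ e.symm.toLinearMap) (l2Image hL f, pairings L κ f)‖ = ‖H f‖ := by rw [he]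
    _ ≤ |C| * nativeNorm L κ f :=
      (hC f).trans (mul_le_mul_of_nonneg_right (le_abs_self C) (Real.sqrt_nonneg _))
    _ ≤ |C| * (√(1 + N₀) * ‖(l2Image hL f, pairings L κ f)‖) := by
      gcongr
      exact nativeNorm_le hL κ f
    _ = |C| * √(1 + N₀) * ‖(l2Image hL f, pairings L κ f)‖ := (mul_assoc _ _ _).symm

end SearchSpace

/-! ### The basis functions -/

section BasisFunction

variable {L : 𝓢'(ℝ, ℂ) →L[ℂ] 𝓢'(ℝ, ℂ)} {Lhat : ℝ → ℂ} {ρ h φ : 𝓢'(ℝ, ℂ)} {hX : X2 L → ℝ}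
  {N₀ M : ℕ} {κ : Fin N₀ → 𝓢(ℝ, ℂ)}

theorem isRealTest_normalTranspose (hL : PreservesReal L) {ψ : 𝓢(ℝ, ℂ)} (hψ : IsRealTest ψ) :
    IsRealTest (normalTranspose L ψ) := by
  have htranspose {χ : 𝓢(ℝ, ℂ)} (hχ : IsRealTest χ) : IsRealTest (transpose L χ) := by
    rw [isRealTest_iff_conjTest_eq] at *
    rw [← transpose_conjTest hL, hχ]
  exact htranspose (isRealTest_reflectTest (htranspose (isRealTest_reflectTest hψ)))

theorem mulEq_fourier_adjoint (hL : PreservesReal L) (hLhat : IsFrequencyResponse L Lhat)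
    (φ : 𝓢'(ℝ, ℂ)) :
    MulEq (fun ξ => ((‖Lhat ξ‖ ^ 2 : ℝ) : ℂ)) (𝓕 φ) (𝓕 (adjoint L (L φ))) := by
  refine fun ψ => ⟨𝓕⁻ (normalTranspose L (𝓕 ψ)), fun ξ => ?_, ?_⟩
  · rw [fourierInv_apply_eq_fourier_neg, fourier_normalTranspose_apply hLhat,
      ← fourierInv_apply_eq_fourier_neg, FourierTransform.fourierInv_fourier_eq, neg_neg,
      mul_comm (Lhat (-ξ)), frequencyResponse_mul_neg hL hLhat]
  · rw [TemperedDistribution.fourier_apply, TemperedDistribution.fourier_apply,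
      FourierTransform.fourier_fourierInv_eq, apply_normalTranspose]

-- `ψ = correlate ρ (L*L ψ)` turns the pairing of `L*L φ` with `ψ` into that of `φ` with a test
-- function orthogonal to the null space.
theorem adjoint_apply_eq_of_convolution (hL : PreservesReal L) (hLhat : IsFrequencyResponse L Lhat)
    (hρ : IsGreenAdjointSelf L ρ)
    (hh : ∀ ψ : 𝓢(ℝ, ℂ), IsRealTest ψ → ∀ hψ : (ψ : 𝓢'(ℝ, ℂ)) ∈ X2 L, h ψ = (hX ⟨ψ, hψ⟩ : ℂ))
    (hconv : ∀ ψ : 𝓢(ℝ, ℂ), IsRealTest ψ → ψ ∈ orthNull L →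
      ∃ hψ : correlate ρ ψ ∈ X2 L, φ ψ = (hX ⟨correlate ρ ψ, hψ⟩ : ℂ)) :
    adjoint L (L φ) = h := by
  refine ext_of_isRealTest fun ψ hψ => ?_
  have hcorr := correlate_normalTranspose hLhat hρ ψ
  obtain ⟨hmem, hφψ⟩ := hconv _ (isRealTest_normalTranspose hL hψ) (transpose_mem_orthNull _)
  rw [← apply_normalTranspose, hφψ, hh ψ hψ (hcorr ▸ hmem)]
  congr 3

theorem isBasisFunction_of_convolution (hL : PreservesReal L)
    (hLhat : IsFrequencyResponse L Lhat) (hρ : IsGreenAdjointSelf L ρ)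
    (hh : ∀ ψ : 𝓢(ℝ, ℂ), IsRealTest ψ → ∀ hψ : (ψ : 𝓢'(ℝ, ℂ)) ∈ X2 L, h ψ = (hX ⟨ψ, hψ⟩ : ℂ))
    (hφ : IsReal φ)
    (hconv : ∀ ψ : 𝓢(ℝ, ℂ), IsRealTest ψ → ψ ∈ orthNull L →
      ∃ hψ : correlate ρ ψ ∈ X2 L, φ ψ = (hX ⟨correlate ρ ψ, hψ⟩ : ℂ)) :
    IsBasisFunction L Lhat ρ h hX φ := by
  have hinv := adjoint_apply_eq_of_convolution hL hLhat hρ hh hconv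
  exact ⟨hφ, hinv ▸ mulEq_fourier_adjoint hL hLhat φ, hinv, hconv⟩

-- `f` accounts for the part of `hX` that factors through `L`, and the correlation of `ρ(-·)` with
-- `κ n`, which is `ρ * κ n`, for the pairing with `κ n`.
theorem isBasisFunction_add_sum_correlate (hL : PreservesReal L)
    (hLhat : IsFrequencyResponse L Lhat) (hρ : IsGreenAdjointSelf L ρ)
    (hκ : ∀ n, IsRealTest (κ n))
    (hh : ∀ ψ : 𝓢(ℝ, ℂ), IsRealTest ψ → ∀ hψ : (ψ : 𝓢'(ℝ, ℂ)) ∈ X2 L, h ψ = (hX ⟨ψ, hψ⟩ : ℂ))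
    {f : X2 L} {c : Fin N₀ → ℝ}
    (hrep : ∀ g, hX g = inner ℝ (l2Image hL f) (l2Image hL g) + ∑ n, c n * pairings L κ g n) :
    IsBasisFunction L Lhat ρ h hX (f + ∑ n, (c n : ℂ) • correlate (reflect ρ) (κ n)) := by
  have happly (ψ : 𝓢(ℝ, ℂ)) :
      ((f : 𝓢'(ℝ, ℂ)) + ∑ n, (c n : ℂ) • correlate (reflect ρ) (κ n)) ψ =
        (f : 𝓢'(ℝ, ℂ)) ψ + ∑ n, (c n : ℂ) * correlate ρ ψ (κ n) := by
    simp [← correlate_reflect_apply ρ ψ]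
  refine isBasisFunction_of_convolution hL hLhat hρ hh (fun ψ hψ => ?_) fun ψ hψ hψL => ?_
  · rw [happly]
    simp [f.2.1 ψ hψ, isReal_correlate hρ.1 hψ _ (hκ _)]
  · have hmem := correlate_mem_X2 hL hLhat hρ hψ hψL
    refine ⟨hmem, ?_⟩
    rw [happly, hrep, apply_eq_inner_correlate hL hLhat hρ hψ hψL hmem, Complex.ofReal_add,
      Complex.ofReal_sum]
    simp_rw [Complex.ofReal_mul, pairings_apply, hmem.1.coe_re_apply (hκ _)]

end BasisFunction

/-! ### The representer theorem -/

section Representer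

variable {L : 𝓢'(ℝ, ℂ) →L[ℂ] 𝓢'(ℝ, ℂ)} {Lhat : ℝ → ℂ} {ρ : 𝓢'(ℝ, ℂ)} {N₀ M : ℕ}
  {p : Module.Basis (Fin N₀) ℝ (nullSpace L)} {κ : Fin N₀ → 𝓢(ℝ, ℂ)}
  {H : X2 L →ₗ[ℝ] (Fin M → ℝ)} {h φ : Fin M → 𝓢'(ℝ, ℂ)}
  {E : (Fin M → ℝ) → (Fin M → ℝ) → ℝ≥0∞} {z : Fin M → ℝ} {lam : ℝ}

theorem exists_eq_inner_add_sum_pairings (hL : PreservesReal L)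
    (hbij : Function.Bijective ((l2Image hL).prod (pairings L κ)))
    (G : realL2 × (Fin N₀ → ℝ) →L[ℝ] ℝ) :
    ∃ (f : X2 L) (c : Fin N₀ → ℝ), ∀ g, G (l2Image hL g, pairings L κ g) =
      inner ℝ (l2Image hL f) (l2Image hL g) + ∑ n, c n * pairings L κ g n := by
  let G₁ := G ∘L ContinuousLinearMap.inl ℝ realL2 (Fin N₀ → ℝ)
  let G₂ := G ∘L ContinuousLinearMap.inr ℝ realL2 (Fin N₀ → ℝ)
  obtain ⟨f, hf⟩ := hbij.surjective ((InnerProductSpace.toDual ℝ realL2).symm G₁, 0)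
  have himage : l2Image hL f = (InnerProductSpace.toDual ℝ realL2).symm G₁ := (Prod.mk.inj hf).1
  have hG₂ (k : Fin N₀ → ℝ) : G₂ k = ∑ n, G₂ (Pi.single n 1) * k n := by
    conv_lhs => rw [pi_eq_sum_univ' k, map_sum]
    simp [mul_comm]
  refine ⟨f, fun n => G₂ (Pi.single n 1), fun g => ?_⟩
  rw [himage, InnerProductSpace.toDual_symm_apply, ← hG₂, ← G.comp_inl_add_comp_inr]

theorem cost_eq_tikhonov (hL : PreservesReal L) :
    cost L H E z lam = tikhonov (E z) lam H (l2Image hL) := by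
  ext f
  rw [cost, tikhonov, l2Norm_apply hL]

theorem IsMinimizer.ne_top (hL : PreservesReal L) (hfeas : ∃ f : X2 L, E z (H f) ≠ ⊤) {f : X2 L}
    (hf : IsMinimizer (cost L H E z lam) f) : E z (H f) ≠ ⊤ := by
  obtain ⟨g, hg⟩ := hfeas
  rw [cost_eq_tikhonov hL] at hf
  exact tikhonov_ne_top_iff.1 (ne_top_of_le_ne_top (tikhonov_ne_top_iff.2 hg) (hf g))

theorem injective_prod_l2Image (hL : PreservesReal L)
    (hH : ∀ q : nullSpace L, H q = 0 → q = 0) :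
    Function.Injective (H.prod (l2Image hL)) := by
  refine (injective_iff_map_eq_zero _).2 fun f hf => ?_
  obtain ⟨hHf, hLf⟩ := Prod.mk.inj hf
  exact congrArg Subtype.val (hH ⟨f, (l2Image_eq_zero_iff hL f).1 hLf⟩ hHf)

theorem exists_isMinimizer (hL : PreservesReal L)
    (hbij : Function.Bijective ((l2Image hL).prod (pairings L κ)))
    {G : realL2 × (Fin N₀ → ℝ) →L[ℝ] (Fin M → ℝ)}
    (hG : ∀ f, H f = G (l2Image hL f, pairings L κ f))
    (hinj : Function.Injective (H.prod (l2Image hL)))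
    (hlsc : LowerSemicontinuous (E z)) (hcoer : IsCoercive (E z))
    (hfeas : ∃ f : X2 L, E z (H f) ≠ ⊤) (hlam : 0 < lam) :
    ∃ f, IsMinimizer (cost L H E z lam) f := by
  have hGinj (k : Fin N₀ → ℝ) (hk : G (0, k) = 0) : k = 0 := by
    obtain ⟨f, hf⟩ := hbij.surjective (0, k)
    obtain ⟨hLf, hκf⟩ := Prod.mk.inj hf
    have hHf : H f = 0 := by rw [hG, ← hk]; exact congrArg G hf
    have hf₀ : f = 0 := (injective_iff_map_eq_zero _).1 hinj f (Prod.ext hHf hLf)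
    rw [← hκf, hf₀]
    exact map_zero (pairings L κ)
  have hcost (f : X2 L) : cost L H E z lam f =
      tikhonov (E z) lam G Prod.fst (l2Image hL f, pairings L κ f) := by
    rw [cost_eq_tikhonov hL, tikhonov, tikhonov, hG]
  obtain ⟨f₀, hf₀⟩ := hfeas
  obtain ⟨x, hx⟩ := exists_tikhonov_le_of_completeSpace hGinj hlsc hcoer hlam (hG f₀ ▸ hf₀)
  obtain ⟨f, rfl⟩ := hbij.surjective x
  exact ⟨f, fun g => by rw [hcost, hcost]; exact hx _⟩

theorem IsMinimizer.eq (hL : PreservesReal L) (hinj : Function.Injective (H.prod (l2Image hL)))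
    (hstrict : IsStrictlyConvex (E z)) (hfeas : ∃ f : X2 L, E z (H f) ≠ ⊤) (hlam : 0 < lam)
    {f g : X2 L} (hf : IsMinimizer (cost L H E z lam) f)
    (hg : IsMinimizer (cost L H E z lam) g) : f = g := by
  have hfH := hf.ne_top hL hfeas
  have hgH := hg.ne_top hL hfeas
  rw [cost_eq_tikhonov hL] at hf hg
  exact eq_of_forall_tikhonov_le hstrict hlam hinj hfH hgH hf hg

theorem IsMinimizer.exists_inner_eq_sum (hL : PreservesReal L)
    (hfeas : ∃ f : X2 L, E z (H f) ≠ ⊤) (hlam : 0 < lam) {f : X2 L}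
    (hf : IsMinimizer (cost L H E z lam) f) :
    ∃ a : Fin M → ℝ, ∀ g, inner ℝ (l2Image hL f) (l2Image hL g) = ∑ m, a m * H g m := by
  have hfH := hf.ne_top hL hfeas
  rw [cost_eq_tikhonov hL] at hf
  exact exists_inner_eq_sum_of_forall_tikhonov_le hlam hfH hf

theorem IsBiorthonormal.eq_sum_add_sum_of_forall_inner_eq (hκ : IsBiorthonormal p κ)
    (hL : PreservesReal L) (hLhat : IsFrequencyResponse L Lhat) (hρ : IsGreenAdjointSelf L ρ)
    (hφ : ∀ m, IsBasisFunction L Lhat ρ (h m) (fun f => H f m) (φ m)) {f : X2 L} {a : Fin M → ℝ}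
    (ha : ∀ g, inner ℝ (l2Image hL f) (l2Image hL g) = ∑ m, a m * H g m) :
    ∃ b : Fin N₀ → ℝ,
      (f : 𝓢'(ℝ, ℂ)) = ∑ m, a m • φ m + ∑ n, b n • ((p n : X2 L) : 𝓢'(ℝ, ℂ)) := by
  have happly (ψ : 𝓢(ℝ, ℂ)) : ((f : 𝓢'(ℝ, ℂ)) - ∑ m, a m • φ m) ψ =
      (f : 𝓢'(ℝ, ℂ)) ψ - ∑ m, (a m : ℂ) * φ m ψ := by
    simp
  have hreal : IsReal ((f : 𝓢'(ℝ, ℂ)) - ∑ m, a m • φ m) := fun ψ hψ => by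
    rw [happly]
    simp [f.2.1 ψ hψ, (hφ _).real ψ hψ]
  refine ⟨_, sub_eq_iff_eq_add'.1 (hκ.eq_sum_of_forall_orthNull hreal fun ψ hψ hψL => ?_)⟩
  have hmem := correlate_mem_X2 hL hLhat hρ hψ hψL
  have hφψ (m : Fin M) : φ m ψ = (H ⟨correlate ρ ψ, hmem⟩ m : ℂ) :=
    ((hφ m).convolution ψ hψ hψL).choose_spec
  rw [happly, apply_eq_inner_correlate hL hLhat hρ hψ hψL hmem, ha, sub_eq_zero]
  simp [hφψ]

end Representer

end Tikhonov

end

theorem theorem1_general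
    (L : 𝓢'(ℝ, ℂ) →L[ℂ] 𝓢'(ℝ, ℂ)) (hL : PreservesReal L)
    (Lhat : ℝ → ℂ) (hLhat : IsFrequencyResponse L Lhat)
    (ρ : 𝓢'(ℝ, ℂ)) (hρ : IsGreenAdjointSelf L ρ)
    (N₀ : ℕ) (p : Module.Basis (Fin N₀) ℝ (nullSpace L))
    (M : ℕ) (h : Fin M → 𝓢'(ℝ, ℂ)) (H : X2 L →ₗ[ℝ] (Fin M → ℝ))
    (hHh : IsGivenBy H h) (hHb : IsBoundedMeasurement p H)
    (hwell : ∀ q r : nullSpace L, H q = H r ↔ q = r)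
    (E : (Fin M → ℝ) → (Fin M → ℝ) → ℝ≥0∞) (z : Fin M → ℝ)
    (hElsc : LowerSemicontinuous (E z)) (hEcoer : IsCoercive (E z))
    (hEfeas : ∃ f : X2 L, E z (H f) ≠ ⊤)
    (lam : ℝ) (hlam : 0 < lam) :
    (∀ m, ∃ φ, IsBasisFunction L Lhat ρ (h m) (fun f => H f m) φ) ∧
    (∃ f, IsMinimizer (cost L H E z lam) f) ∧
    (IsStrictlyConvex (E z) → ∃! f, IsMinimizer (cost L H E z lam) f) ∧
    ∀ φ : Fin M → 𝓢'(ℝ, ℂ),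
      (∀ m, IsBasisFunction L Lhat ρ (h m) (fun f => H f m) (φ m)) →
      ∀ f₂, IsMinimizer (cost L H E z lam) f₂ →
        ∃ (a : Fin M → ℝ) (b : Fin N₀ → ℝ),
          (f₂ : 𝓢'(ℝ, ℂ)) = ∑ m, a m • φ m + ∑ n, b n • ((p n : X2 L) : 𝓢'(ℝ, ℂ)) ∧
          ∀ n, ∑ m, a m * H (p n) m = 0 := by
  obtain ⟨κ, hκreal, hκp, C, hC⟩ := hHb
  have hκ : IsBiorthonormal p κ := ⟨hκreal, hκp⟩
  have hbij := hκ.bijective_l2Image_prod_pairings hL hLhat hρ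
  have hinj := injective_prod_l2Image hL fun q hq => (hwell q 0).1 (by simpa using hq)
  obtain ⟨G, hG⟩ := exists_continuousLinearMap_factorization hL hbij hC
  obtain ⟨f, hf⟩ := exists_isMinimizer hL hbij hG hinj hElsc hEcoer hEfeas hlam
  refine ⟨fun m => ?_, ⟨f, hf⟩, fun hstrict => ?_, fun φ hφ f₂ hf₂ => ?_⟩
  · obtain ⟨g, c, hrep⟩ :=
      exists_eq_inner_add_sum_pairings hL hbij (ContinuousLinearMap.proj m ∘L G)
    exact ⟨_, isBasisFunction_add_sum_correlate hL hLhat hρ hκreal (hHh m)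
      fun g => (congrFun (hG g) m).trans (hrep g)⟩
  · exact ⟨f, hf, fun g hg => hg.eq hL hinj hstrict hEfeas hlam hf⟩
  · obtain ⟨a, ha⟩ := hf₂.exists_inner_eq_sum hL hEfeas hlam
    obtain ⟨b, hb⟩ := hκ.eq_sum_add_sum_of_forall_inner_eq hL hLhat hρ hφ ha
    refine ⟨a, b, hb, fun n => ?_⟩
    rw [← ha, (l2Image_eq_zero_iff hL _).2 (p n).2, inner_zero_right]

theorem theorem1
    (L : 𝓢'(ℝ, ℂ) →L[ℂ] 𝓢'(ℝ, ℂ)) (hL : SplineAdmissible L)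
    (Lhat : ℝ → ℂ) (hLhat : IsFrequencyResponse L Lhat)
    (ρ : 𝓢'(ℝ, ℂ)) (hρ : IsGreenAdjointSelf L ρ)
    (N₀ : ℕ) (p : Module.Basis (Fin N₀) ℝ (nullSpace L))
    (M : ℕ) (h : Fin M → 𝓢'(ℝ, ℂ)) (H : X2 L →ₗ[ℝ] (Fin M → ℝ))
    (hHh : IsGivenBy H h) (hHb : IsBoundedMeasurement p H)
    (hwell : ∀ q r : nullSpace L, H q = H r ↔ q = r)
    (E : (Fin M → ℝ) → (Fin M → ℝ) → ℝ≥0∞) (z : Fin M → ℝ)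
    (hEconv : IsConvex (E z)) (hElsc : LowerSemicontinuous (E z)) (hEcoer : IsCoercive (E z))
    (hEfeas : ∃ f : X2 L, E z (H f) ≠ ⊤)
    (lam : ℝ) (hlam : 0 < lam) :
    (∀ m, ∃ φ, IsBasisFunction L Lhat ρ (h m) (fun f => H f m) φ) ∧
    (∃ f, IsMinimizer (cost L H E z lam) f) ∧
    (IsStrictlyConvex (E z) → ∃! f, IsMinimizer (cost L H E z lam) f) ∧
    ∀ φ : Fin M → 𝓢'(ℝ, ℂ),
      (∀ m, IsBasisFunction L Lhat ρ (h m) (fun f => H f m) (φ m)) →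
      ∀ f₂, IsMinimizer (cost L H E z lam) f₂ →
        ∃ (a : Fin M → ℝ) (b : Fin N₀ → ℝ),
          (f₂ : 𝓢'(ℝ, ℂ)) = ∑ m, a m • φ m + ∑ n, b n • ((p n : X2 L) : 𝓢'(ℝ, ℂ)) ∧
          ∀ n, ∑ m, a m * H (p n) m = 0 := by
  exact theorem1_general L hL.real Lhat hLhat ρ hρ N₀ p M h H hHh hHb hwell E z hElsc hEcoer hEfeas
    lam hlam
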